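/- Conventions. A tropical polynomial in three variables is $f=\max_{a\in\mathcal A}(\lambda_a+a_1x_1+a_2x_2+a_3x_3)$ with $\mathcal A\subset\mathbb Z^3$ finite and nonempty and $\lambda_a\in\mathbb R$; it is homogeneous if $a_1+a_2+a_3$ is the same for all $a\in\mathcal A$. Its Newton polygon is $\Delta_f=\operatorname{conv}(\mathcal A)$. The tropical plane curve $C=V(f)$ of a homogeneous $f$ is the set of points of $\mathbb P^2_{tr}=\mathbb R^3/\mathbb R(1,1,1)$ near which $f$ is not linear. For a point $x$, the dual cell is the convex hull of those $a\in\mathcal A$ for which $\lambda_a+a\cdot x=f(x)$. The vertices of $C$ are the points of $C$ with two-dimensional dual cell; the other points of $C$ lie on edges, and the weight of an edge is the lattice length of its dual cell. Curves are considered together with these weights, i.e. as given by $f$. Let $\Gamma_d\subset\mathbb R^3$ be the triangle with vertices $(d,0,0),(0,d,0),(0,0,d)$. The curve $C$ has degree $d\in\mathbb N_0$ if $d$ is least such that some lattice translate of $\Delta_f$ is contained in $\Gamma_d$, and it has degree $d$ with full support if some lattice translate of $\Delta_f$ equals $\Gamma_d$. Two curves intersect transversally if no vertex of one lies on the other. If,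 in such an intersection, edges of weights $m_1,m_2$ and with primitive direction vectors $v,w$ (in $\mathbb Z^3/\mathbb Z(1,1,1)$) meet at $P$, then the intersection multiplicity at $P$ is $m_1m_2\left|\det\begin{pmatrix}v_0&v_1&v_2\\ w_0&w_1&w_2\\ 1&1&1\end{pmatrix}\right|$. The stable intersection $C\cap_{st}D$ is the limit, as finite multisets of points, of the intersections (counted with multiplicities) of translates $C+u$ and $D+v$ that intersect transversally, as $(u,v)\to 0$. Theorem (strong version of tropical Bezout). Let $C$ and $D$ be tropical plane curves of degrees $c$ and $d$, respectively. If at least one of them has full support, then their stable intersection exists, is unique, and consists of exactly $cd$ points, counted with multiplicities. -/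

import Mathlib

open Filter Topology

/-- A tropical (Laurent) polynomial in `n` indeterminates over the max-plus semifield: a finite
nonempty support of exponent vectors and a real coefficient for each exponent of the support
(the values of `coeff` off the support play no role). -/
structure TropPoly (n : ℕ) where
  support : Finset (Fin n → ℤ)
  nonempty : support.Nonempty
  coeff : (Fin n → ℤ) → ℝ

/-- The tropical projective space `ℝ^(n+1) / ℝ·(1,…,1)`, with the quotient norm. -/
abbrev TropProj (n : ℕ) : Type := (Fin (n + 1) → ℝ) ⧸ Submodule.span ℝ {(1 : Fin (n + 1) → ℝ)}

/-- The class of a vector in tropical projective space. -/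
def TropProj.mk {n : ℕ} (x : Fin (n + 1) → ℝ) : TropProj n :=
  Submodule.Quotient.mk x

/-- An integer vector regarded as a real vector. -/
def intVec {n : ℕ} (a : Fin n → ℤ) : Fin n → ℝ := fun i => (a i : ℝ)

namespace TropPoly

noncomputable section

variable {n : ℕ}

/-- The value at `x` of the tropical monomial of `f` with exponent `a`. -/
def monomial (f : TropPoly n) (a : Fin n → ℤ) (x : Fin n → ℝ) : ℝ :=
  f.coeff a + ∑ i, (a i : ℝ) * x i

/-- The function `ℝ^n → ℝ` associated with `f`, the maximum of its monomials. -/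
def eval (f : TropPoly n) (x : Fin n → ℝ) : ℝ :=
  f.support.sup' f.nonempty fun a => f.monomial a x

/-- `f` is homogeneous of degree `k`. -/
def IsHomogeneous (f : TropPoly n) (k : ℤ) : Prop :=
  ∀ a ∈ f.support, ∑ i, a i = k

/-- The Newton polytope of `f`. -/
def newtonPolytope (f : TropPoly n) : Set (Fin n → ℝ) :=
  convexHull ℝ (intVec '' (f.support : Set (Fin n → ℤ)))

/-- The tropical variety `V(f)`: the points near which `f` is not (affine-)linear.
For homogeneous `f` it is invariant under translation by multiples of `(1,…,1)`, and the tropical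
projective variety of `f` is its image in tropical projective space. -/
def variety (f : TropPoly n) : Set (Fin n → ℝ) :=
  {x | ¬ ∃ φ : (Fin n → ℝ) →ᵃ[ℝ] ℝ, ∀ᶠ y in 𝓝 x, f.eval y = φ y}

/-- The cell of the subdivision `Subdiv_f` of the Newton polytope that is dual to the point `x`:
the convex hull of the exponents whose monomials attain the maximum at `x`. Equivalently, it is
the projection of the upper face, in direction `(x, 1)`, of the convex hull of the lifted
points `(a, coeff a)`. -/
def dualCell (f : TropPoly n) (x : Fin n → ℝ) : Set (Fin n → ℝ) :=
  convexHull ℝ (intVec '' {a : Fin n → ℤ | a ∈ f.support ∧ f.monomial a x = f.eval x})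

/-- The translate of `f` by `u`; it defines the translate by `u` of the tropical variety of `f`,
see `eval_translate`. -/
def translate (f : TropPoly n) (u : Fin n → ℝ) : TropPoly n where
  support := f.support
  nonempty := f.nonempty
  coeff := fun a => f.coeff a - ∑ i, (a i : ℝ) * u i

theorem eval_translate (f : TropPoly n) (u x : Fin n → ℝ) :
    (f.translate u).eval x = f.eval (x - u) := by
  have h : ∀ a, (f.translate u).monomial a x = f.monomial a (x - u) := by
    intro a
    simp only [monomial, translate, Pi.sub_apply, mul_sub, Finset.sum_sub_distrib]
    ring
  unfold eval
  simp only [h]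
  rfl

/-! ### Plane tropical curves, given by homogeneous tropical polynomials in three variables

All notions at a vector `x : Fin 3 → ℝ` below depend, for homogeneous polynomials, only on the
point of the tropical projective plane represented by `x`. -/

/-- The triangle `Γ_d` with vertices `(d,0,0)`, `(0,d,0)`, `(0,0,d)`. -/
def triangle (d : ℕ) : Set (Fin 3 → ℝ) :=
  convexHull ℝ {![(d : ℝ), 0, 0], ![0, (d : ℝ), 0], ![0, 0, (d : ℝ)]}

/-- The Newton polygon of `f` fits inside `Γ_d`, i.e. some lattice translate of it (the Newton
polygon of the product of `f` with a monomial) is contained in `Γ_d`. -/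
def FitsInside (f : TropPoly 3) (d : ℕ) : Prop :=
  ∃ t : Fin 3 → ℤ, (fun p => p + intVec t) '' f.newtonPolytope ⊆ triangle d

/-- The tropical curve of `f` has degree `d`: the Newton polygon fits inside `Γ_d`, but not
inside a smaller triangle. -/
def HasDegree (f : TropPoly 3) (d : ℕ) : Prop :=
  f.FitsInside d ∧ ∀ e < d, ¬ f.FitsInside e

/-- The tropical curve of `f` has degree `d` with full support: the Newton polygon is `Γ_d`, up
to a lattice translation. -/
def HasFullSupport (f : TropPoly 3) (d : ℕ) : Prop :=
  ∃ t : Fin 3 → ℤ, (fun p => p + intVec t) '' f.newtonPolytope = triangle d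

/-- `x` represents a vertex of the tropical curve of `f`: its dual cell is two-dimensional. -/
def IsVertex (f : TropPoly 3) (x : Fin 3 → ℝ) : Prop :=
  x ∈ f.variety ∧ Module.finrank ℝ (vectorSpan ℝ (f.dualCell x)) = 2

/-- The weight of the edge of the tropical curve of `f` through `x` (a point of the curve that is
not a vertex): the lattice length of the dual segment, which is one less than the number of
lattice points on the segment, endpoints included. -/
def weight (f : TropPoly 3) (x : Fin 3 → ℝ) : ℕ :=
  {a : Fin 3 → ℤ | intVec a ∈ f.dualCell x}.ncard - 1

/-- `v` is a direction vector of the edge of the tropical curve of `f` through `x`, primitive in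
the lattice `ℤ³ / ℤ·(1,1,1)` of the tropical projective plane. -/
def IsPrimitiveDirection (f : TropPoly 3) (x : Fin 3 → ℝ) (v : Fin 3 → ℤ) : Prop :=
  Int.gcd (v 0 - v 2) (v 1 - v 2) = 1 ∧ ∀ᶠ t : ℝ in 𝓝 0, x + t • intVec v ∈ f.variety

/-- A primitive direction vector of the edge through `x`; it is unique up to sign and up to
adding multiples of `(1,1,1)`. -/
def primitiveDirection (f : TropPoly 3) (x : Fin 3 → ℝ) : Fin 3 → ℤ :=
  Classical.epsilon (f.IsPrimitiveDirection x)

/-- The curves of `f` and `g` intersect transversally: no vertex of one lies on the other. -/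
def Transversal (f g : TropPoly 3) : Prop :=
  (∀ x, f.IsVertex x → x ∉ g.variety) ∧ ∀ x, g.IsVertex x → x ∉ f.variety

open Classical in
/-- The intersection multiplicity of the curves of `f` and `g`, intersecting transversally, at the
point represented by `x` (zero if this is not an intersection point). -/
def intersectionMultiplicity (f g : TropPoly 3) (x : Fin 3 → ℝ) : ℕ :=
  if x ∈ f.variety ∧ x ∈ g.variety then
    let v := f.primitiveDirection x
    let w := g.primitiveDirection x
    f.weight x * g.weight x *
      (Matrix.det !![v 0, v 1, v 2; w 0, w 1, w 2; 1, 1, 1]).natAbs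
  else 0

open Classical in
/-- The finite multiset `T` of points of the tropical projective plane is the intersection of the
curves of `f` and `g`, which intersect transversally, counted with multiplicities. -/
def IsTransversalIntersection (f g : TropPoly 3) (T : Multiset (TropProj 2)) : Prop :=
  ∀ x : Fin 3 → ℝ, T.count (TropProj.mk x) = intersectionMultiplicity f g x

/-- The finite multiset `S` of points of the tropical projective plane is the stable intersection
of the curves `C` of `f` and `D` of `g`: it is the limit of the intersections, counted with
multiplicities, of translates `C + u` and `D + v` that intersect transversally, as `(u, v) → 0`.
Finite multisets `T` converge to `S` if, for every `ε > 0`, eventually the points of `T` can be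
matched with those of `S` so that matched points have distance less than `ε`. -/
def IsStableIntersection (f g : TropPoly 3) (S : Multiset (TropProj 2)) : Prop :=
  ∀ ε > (0 : ℝ), ∀ᶠ p : (Fin 3 → ℝ) × (Fin 3 → ℝ) in 𝓝 0,
    Transversal (f.translate p.1) (g.translate p.2) →
      ∃ T : Multiset (TropProj 2),
        IsTransversalIntersection (f.translate p.1) (g.translate p.2) T ∧
          Multiset.Rel (fun P Q => dist P Q < ε) T S

end

end TropPoly

/-! Setting the last coordinate to zero turns a homogeneous `f` into a maximum of affine functions
on the plane. The slopes of the members maximal at a point `x` span the dual cell of `x`, and the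
two-dimensional dual cells tile the projected Newton polygon (`MaxAffine.volume_hull`). Multiplying
polynomials adds the functions, and the cell of a product at `x` is the Minkowski sum of the two
cells (`MaxAffine.cell_mul`). Subtracting areas, the mixed areas of the pairs of cells at all points
`x` add up to the mixed area of the two Newton polygons (`MaxAffine.exists_sum_mixedArea`).

At a transversal intersection point both cells are segments, and their mixed area is the area of a
parallelogram, which is the intersection multiplicity (`intersectionMultiplicity_eq_mixedArea`).
Hence all transversal intersections of translates have the same total.

The same count, applied to the members that are maximal at a single point `y`, shows that under
small translations the multiplicities near `y` add up to the mixed area of the two cells at `y`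
(`MaxAffine.exists_sum_shiftedMixedArea`). So the transversal intersections converge to a fixed
multiset. The limit is unique because almost every translation is transversal (`ae_transversal`).

It remains to evaluate the mixed area when one polygon is a standard triangle of size `c`: it is `c`
times the size of the smallest standard triangle around the other polygon
(`mixedArea_planeTriangle`), and that size is the degree (`HasDegree.eq`). -/

section Planar

open MeasureTheory
open scoped Pointwise

/-! ### Maxima of affine functions, the tiling by dual cells, and the global mixed area count. -/

/-- The standard pairing on the plane. -/
def planeDot (p x : ℝ × ℝ) : ℝ := p.1 * x.1 + p.2 * x.2

/-- The mixed area of two plane sets. -/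
noncomputable def mixedArea (P Q : Set (ℝ × ℝ)) : ℝ :=
  volume.real (P + Q) - volume.real P - volume.real Q

theorem planeDot_sub_right (p x y : ℝ × ℝ) : planeDot p (x - y) = planeDot p x - planeDot p y := by
  simp only [planeDot, Prod.fst_sub, Prod.snd_sub]; ring

theorem continuous_planeDot_right (p : ℝ × ℝ) : Continuous (planeDot p) := by
  unfold planeDot; fun_prop

theorem convex_planeDot_le (x : ℝ × ℝ) (c : ℝ) : Convex ℝ {p | planeDot p x ≤ c} := by
  refine convex_halfSpace_le (f := fun p => planeDot p x) ?_ c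
  constructor
  · intro p q; simp only [planeDot, Prod.fst_add, Prod.snd_add]; ring
  · intro t p; simp only [planeDot, Prod.smul_fst, Prod.smul_snd, smul_eq_mul]; ring

theorem volume_line_eq_zero {w : ℝ × ℝ} (hw : w ≠ 0) (c : ℝ) :
    volume {p | planeDot p w = c} = 0 := by
  let s : AffineSubspace ℝ (ℝ × ℝ) :=
    { carrier := {p | planeDot p w = c}
      smul_vsub_vadd_mem' := by
        intro t p q r (hp : planeDot p w = c) (hq : planeDot q w = c) (hr : planeDot r w = c)
        change planeDot _ w = c
        simp only [planeDot, vsub_eq_sub, vadd_eq_add, Prod.fst_add, Prod.snd_add,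
          Prod.smul_fst, Prod.smul_snd, Prod.fst_sub, Prod.snd_sub, smul_eq_mul] at *
        linear_combination t * hp - t * hq + hr }
  refine Measure.addHaar_affineSubspace volume s ?_
  intro h
  have h1 : (0 : ℝ × ℝ) ∈ s := h ▸ AffineSubspace.mem_top ℝ _ _
  have h2 : w ∈ s := h ▸ AffineSubspace.mem_top ℝ _ _
  have h1' : planeDot 0 w = c := h1
  have h2' : planeDot w w = c := h2
  simp only [planeDot, Prod.fst_zero, Prod.snd_zero] at h1' h2'
  apply hw
  ext
  · simp only [Prod.fst_zero]; nlinarith [mul_self_nonneg w.1, mul_self_nonneg w.2]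
  · simp only [Prod.snd_zero]; nlinarith [mul_self_nonneg w.1, mul_self_nonneg w.2]

/-- A finite nonempty family of affine functions on the plane; its maximum is a piecewise
affine convex function. -/
structure MaxAffine (ι : Type*) where
  support : Finset ι
  nonempty : support.Nonempty
  slope : ι → ℝ × ℝ
  const : ι → ℝ

namespace MaxAffine

variable {ι κ : Type*}

/-- The value at `x` of a member of the family. -/
def term (h : MaxAffine ι) (i : ι) (x : ℝ × ℝ) : ℝ := h.const i + planeDot (h.slope i) x

/-- The indices of the members of the family that are maximal at `x`. -/
def active (h : MaxAffine ι) (x : ℝ × ℝ) : Set ι :=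
  {i | i ∈ h.support ∧ ∀ j ∈ h.support, h.term j x ≤ h.term i x}

/-- The convex hull of the slopes of the members that are maximal at `x`. -/
def cell (h : MaxAffine ι) (x : ℝ × ℝ) : Set (ℝ × ℝ) := convexHull ℝ (h.slope '' h.active x)

/-- The convex hull of all slopes. -/
def hull (h : MaxAffine ι) : Set (ℝ × ℝ) := convexHull ℝ (h.slope '' (h.support : Set ι))

/-- The maximum of the family. -/
noncomputable def value (h : MaxAffine ι) (x : ℝ × ℝ) : ℝ :=
  h.support.sup' h.nonempty fun i => h.term i x

theorem active_subset (h : MaxAffine ι) (x : ℝ × ℝ) : h.active x ⊆ h.support := fun _ hi => hi.1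

theorem active_nonempty (h : MaxAffine ι) (x : ℝ × ℝ) : (h.active x).Nonempty := by
  obtain ⟨i, hi, hm⟩ := Finset.exists_max_image h.support (fun i => h.term i x) h.nonempty
  exact ⟨i, hi, hm⟩

theorem finite_active (h : MaxAffine ι) (x : ℝ × ℝ) : (h.active x).Finite :=
  h.support.finite_toSet.subset (h.active_subset x)

theorem value_eq_term {h : MaxAffine ι} {x : ℝ × ℝ} {i : ι} (hi : i ∈ h.active x) :
    h.value x = h.term i x :=
  le_antisymm (Finset.sup'_le _ _ hi.2) (Finset.le_sup' (fun i => h.term i x) hi.1)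

theorem term_le_value {h : MaxAffine ι} {i : ι} (hi : i ∈ h.support) (x : ℝ × ℝ) :
    h.term i x ≤ h.value x := Finset.le_sup' (fun i => h.term i x) hi

theorem continuous_term (h : MaxAffine ι) (i : ι) : Continuous (h.term i) :=
  continuous_const.add (continuous_planeDot_right _)

theorem continuous_value (h : MaxAffine ι) : Continuous h.value :=
  Continuous.finset_sup'_apply h.nonempty fun i _ => h.continuous_term i

theorem term_add_planeDot (h : MaxAffine ι) (i : ι) (x y : ℝ × ℝ) :
    h.term i x + planeDot (h.slope i) (y - x) = h.term i y := by
  rw [planeDot_sub_right, term, term]; ring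

/-- The points of the cell at `x` are subgradients of the convex function `value` at `x`: true for
active slopes, and the condition on `p` is a half-plane, so it passes to the convex hull. -/
theorem value_add_planeDot_le {h : MaxAffine ι} {x p : ℝ × ℝ} (hp : p ∈ h.cell x) (y : ℝ × ℝ) :
    h.value x + planeDot p (y - x) ≤ h.value y := by
  have : h.cell x ⊆ {p | planeDot p (y - x) ≤ h.value y - h.value x} := by
    refine convexHull_min ?_ (convex_planeDot_le _ _)
    rintro _ ⟨i, hi, rfl⟩
    have h1 := h.term_add_planeDot i x y
    have h2 := term_le_value hi.1 y
    rw [Set.mem_ofPred_eq, value_eq_term hi]; linarith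
  have := this hp
  rw [Set.mem_ofPred_eq] at this
  linarith

theorem cell_subset_hull (h : MaxAffine ι) (x : ℝ × ℝ) : h.cell x ⊆ h.hull :=
  convexHull_mono (Set.image_mono (h.active_subset x))

theorem isCompact_cell (h : MaxAffine ι) (x : ℝ × ℝ) : IsCompact (h.cell x) :=
  ((h.finite_active x).image _).isCompact_convexHull ℝ

theorem isCompact_hull (h : MaxAffine ι) : IsCompact h.hull :=
  (h.support.finite_toSet.image _).isCompact_convexHull ℝ

/-- A common point of the two cells is a subgradient at both `x` and `y`; the two inequalities
together put it on a line. -/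
theorem volume_cell_inter_cell (h : MaxAffine ι) {x y : ℝ × ℝ} (hxy : x ≠ y) :
    volume (h.cell x ∩ h.cell y) = 0 := by
  refine measure_mono_null ?_ (volume_line_eq_zero (sub_ne_zero.2 hxy.symm) (h.value y - h.value x))
  rintro p ⟨hx, hy⟩
  have h1 := value_add_planeDot_le hx y
  have h2 := value_add_planeDot_le hy x
  rw [planeDot_sub_right] at h1 h2
  rw [Set.mem_ofPred_eq, planeDot_sub_right]
  linarith

theorem finite_cells (h : MaxAffine ι) : (Set.range h.cell).Finite := by
  refine (h.support.finite_toSet.finite_subsets.image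
    fun s => convexHull ℝ (h.slope '' s)).subset ?_
  rintro _ ⟨x, rfl⟩
  exact ⟨_, h.active_subset x, rfl⟩

/-- Distinct points have cells with null intersection, so `cell` is injective on these points, and
it has finite range. -/
theorem finite_volume_cell_ne_zero (h : MaxAffine ι) : {x | volume (h.cell x) ≠ 0}.Finite := by
  refine Set.Finite.of_finite_image (f := h.cell)
    (h.finite_cells.subset (Set.image_subset_range _ _)) ?_
  intro x hx y _ hxy
  by_contra hne
  have := h.volume_cell_inter_cell hne
  rw [← show h.cell x = h.cell y from hxy, Set.inter_self] at this
  exact hx this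

theorem eventually_term_le (h : MaxAffine ι) (x : ℝ × ℝ) :
    ∀ᶠ y in 𝓝 x, ∀ i ∈ h.support, i ∉ h.active x → ∀ j ∈ h.active x, h.term i y < h.term j y := by
  rw [Filter.eventually_all_finset]
  intro i hi
  by_cases hx : i ∈ h.active x
  · exact Eventually.of_forall fun y hy => absurd hx hy
  simp only [hx, not_false_eq_true, true_imp_iff]
  refine (Filter.eventually_all_finite (h.finite_active x)).2 fun j hj => ?_
  refine (h.continuous_term i).continuousAt.eventually_lt (h.continuous_term j).continuousAt ?_
  refine lt_of_le_of_ne (hj.2 i hi) fun he => hx ⟨hi, fun k hk => ?_⟩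
  rw [he]; exact hj.2 k hk

theorem active_subset_of_nhds (h : MaxAffine ι) (x : ℝ × ℝ) :
    ∀ᶠ y in 𝓝 x, h.active y ⊆ h.active x := by
  filter_upwards [h.eventually_term_le x] with y hy i hi
  by_contra hx
  obtain ⟨j, hj⟩ := h.active_nonempty x
  exact absurd (hi.2 j hj.1) (not_le.2 (hy i hi.1 hx j hj))

/-- Converse of `value_add_planeDot_le`. A separating functional between `p` and the cell gives a
direction `v` in which every active slope is less than `p`; a small step from `x` along `v` would
then go below the minimum. -/
theorem mem_cell_of_isMinOn {h : MaxAffine ι} {p x : ℝ × ℝ}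
    (hx : ∀ y, h.value x - planeDot p x ≤ h.value y - planeDot p y) : p ∈ h.cell x := by
  by_contra hp
  obtain ⟨φ, c, h1, h2⟩ := geometric_hahn_banach_closed_point (convex_convexHull ℝ _)
    (h.isCompact_cell x).isClosed hp
  let v : ℝ × ℝ := (φ (1, 0), φ (0, 1))
  have hv : ∀ q, φ q = planeDot q v := by
    intro q
    have : q = q.1 • (1, 0) + q.2 • (0, 1) := by ext <;> simp
    conv_lhs => rw [this]
    rw [map_add, map_smul, map_smul]; rfl
  have hlim : Tendsto (fun t : ℝ => x + t • v) (𝓝[>] 0) (𝓝 x) := by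
    have : Tendsto (fun t : ℝ => x + t • v) (𝓝 0) (𝓝 (x + (0 : ℝ) • v)) :=
      Continuous.tendsto (by fun_prop) 0
    rw [zero_smul, add_zero] at this
    exact this.mono_left nhdsWithin_le_nhds
  obtain ⟨t, ht, ht0⟩ := ((hlim.eventually (h.active_subset_of_nhds x)).and
    (eventually_mem_nhdsWithin)).exists
  rw [Set.mem_Ioi] at ht0
  obtain ⟨i, hi⟩ := h.active_nonempty (x + t • v)
  have h3 := h1 _ (subset_convexHull ℝ _ (Set.mem_image_of_mem h.slope (ht hi)))
  have h4 := hx (x + t • v)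
  rw [value_eq_term hi, value_eq_term (ht hi)] at h4
  rw [hv] at h2 h3
  have h5 : planeDot (h.slope i) v < planeDot p v := h3.trans h2
  simp only [term, planeDot, Prod.fst_add, Prod.snd_add, Prod.smul_fst, Prod.smul_snd,
    smul_eq_mul] at h4 h5
  nlinarith

/-- For `p` in the interior of the hull, `value` minus the linear function of `p` is coercive, so it
attains its minimum, and there `p` is a subgradient. -/
theorem exists_mem_cell {h : MaxAffine ι} {p : ℝ × ℝ} (hp : p ∈ interior h.hull) :
    ∃ x, p ∈ h.cell x := by
  obtain ⟨r, hr, hball⟩ := Metric.isOpen_iff.1 isOpen_interior p hp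
  obtain ⟨m, hm⟩ : ∃ m, ∀ i ∈ h.support, m ≤ h.const i :=
    ⟨h.support.inf' h.nonempty h.const, fun i hi => Finset.inf'_le _ hi⟩
  have hbound : ∀ x, ∀ q ∈ h.hull, m + planeDot q x ≤ h.value x := by
    intro x q hq
    have : h.hull ⊆ {q | planeDot q x ≤ h.value x - m} := by
      refine convexHull_min ?_ (convex_planeDot_le _ _)
      rintro _ ⟨i, hi, rfl⟩
      have h1 := term_le_value hi x
      have h2 := hm i hi
      rw [term] at h1
      rw [Set.mem_ofPred_eq]; linarith
    have := this hq
    rw [Set.mem_ofPred_eq] at this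
    linarith
  have hlow : ∀ x, m + r / 2 * ‖x‖ ≤ h.value x - planeDot p x := by
    intro x
    -- The point `p + (r / 2) • w` is still in the hull. As the norm is the sup norm, the four
    -- signed unit vectors `w` suffice to recover `‖x‖`.
    have key : ∀ w : ℝ × ℝ, ‖w‖ ≤ 1 → m + r / 2 * planeDot w x ≤ h.value x - planeDot p x := by
      intro w hw
      have := hbound x (p + (r / 2) • w) (interior_subset (hball (by
        rw [Metric.mem_ball, dist_eq_norm, add_sub_cancel_left, norm_smul, Real.norm_eq_abs,
          abs_of_pos (by linarith)]
        nlinarith [norm_nonneg w])))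
      simp only [planeDot, Prod.fst_add, Prod.snd_add, Prod.smul_fst, Prod.smul_snd,
        smul_eq_mul] at this ⊢
      linarith
    rw [Prod.norm_def, Real.norm_eq_abs, Real.norm_eq_abs]
    have k1 := key (1, 0) (by simp [Prod.norm_def])
    have k2 := key (-1, 0) (by simp [Prod.norm_def])
    have k3 := key (0, 1) (by simp [Prod.norm_def])
    have k4 := key (0, -1) (by simp [Prod.norm_def])
    simp only [planeDot] at k1 k2 k3 k4 ⊢
    rcases max_cases |x.1| |x.2| with ⟨he, -⟩ | ⟨he, -⟩ <;> rw [he]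
    · rcases abs_cases x.1 with ⟨he, -⟩ | ⟨he, -⟩ <;> rw [he] <;> linarith
    · rcases abs_cases x.2 with ⟨he, -⟩ | ⟨he, -⟩ <;> rw [he] <;> linarith
  have hcoer : Tendsto (fun x => h.value x - planeDot p x) (cocompact (ℝ × ℝ)) atTop := by
    refine tendsto_atTop_mono hlow (tendsto_atTop_add_const_left _ _ ?_)
    exact tendsto_norm_cocompact_atTop.const_mul_atTop (by linarith)
  obtain ⟨x, hx⟩ := (h.continuous_value.sub (continuous_planeDot_right p)).exists_forall_le hcoer
  exact ⟨x, mem_cell_of_isMinOn hx⟩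

/-- The cells cover the interior of the hull and overlap in null sets. What the points of `X` miss
lies in the frontier of the hull, null by convexity, or in one of the finitely many null cells. -/
theorem volume_hull (h : MaxAffine ι) (X : Finset (ℝ × ℝ))
    (hX : ∀ x, volume (h.cell x) ≠ 0 → x ∈ X) :
    volume.real h.hull = ∑ x ∈ X, volume.real (h.cell x) := by
  have h1 : volume.real (⋃ x ∈ X, h.cell x) = ∑ x ∈ X, volume.real (h.cell x) := by
    refine measureReal_biUnion_finset₀ (fun x _ y _ hxy => h.volume_cell_inter_cell hxy)
      (fun x _ => (h.isCompact_cell x).measurableSet.nullMeasurableSet)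
      (fun x _ => (h.isCompact_cell x).measure_lt_top.ne)
  rw [← h1]
  refine (measureReal_congr ?_)
  refine (ae_eq_of_subset_of_measure_ge (μ := volume) (Set.iUnion₂_subset fun x _ => h.cell_subset_hull x)
    ?_ ?_ h.isCompact_hull.measure_lt_top.ne).symm
  · have hnull : volume (frontier h.hull ∪ ⋃ s ∈ {s ∈ Set.range h.cell | volume s = 0}, s) = 0 := by
      rw [measure_union_null_iff, measure_biUnion_null_iff (h.finite_cells.subset fun _ hs => hs.1).countable]
      exact ⟨(convex_convexHull ℝ _).addHaar_frontier _, fun s hs => hs.2⟩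
    rw [← zero_add (volume (⋃ x ∈ X, h.cell x)), ← hnull]
    refine (measure_mono ?_).trans (measure_union_le _ _)
    intro p hp
    by_cases hi : p ∈ interior h.hull
    · obtain ⟨x, hx⟩ := exists_mem_cell hi
      by_cases hv : volume (h.cell x) = 0
      · exact Or.inl (Or.inr (Set.mem_biUnion ⟨⟨x, rfl⟩, hv⟩ hx))
      · exact Or.inr (Set.mem_biUnion (hX x hv) hx)
    · exact Or.inl (Or.inl ⟨subset_closure hp, hi⟩)
  · exact (Finset.measurableSet_biUnion X fun x _ => (h.isCompact_cell x).measurableSet).nullMeasurableSet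

/-- The family of pairwise sums. -/
def mul (h : MaxAffine ι) (k : MaxAffine κ) : MaxAffine (ι × κ) where
  support := h.support ×ˢ k.support
  nonempty := h.nonempty.product k.nonempty
  slope := fun i => h.slope i.1 + k.slope i.2
  const := fun i => h.const i.1 + k.const i.2

theorem active_mul (h : MaxAffine ι) (k : MaxAffine κ) (x : ℝ × ℝ) :
    (h.mul k).active x = h.active x ×ˢ k.active x := by
  have ht : ∀ i j, (h.mul k).term (i, j) x = h.term i x + k.term j x := by
    intro i j; simp only [term, mul, planeDot, Prod.fst_add, Prod.snd_add]; ring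
  ext ⟨i, j⟩
  constructor
  · rintro ⟨h1, h2⟩
    have h1' := Finset.mem_product.1 h1
    refine ⟨⟨h1'.1, fun i' hi' => ?_⟩, ⟨h1'.2, fun j' hj' => ?_⟩⟩
    · have := h2 (i', j) (Finset.mem_product.2 ⟨hi', h1'.2⟩)
      rw [ht, ht] at this; linarith
    · have := h2 (i, j') (Finset.mem_product.2 ⟨h1'.1, hj'⟩)
      rw [ht, ht] at this; linarith
  · rintro ⟨h1, h2⟩
    refine ⟨Finset.mem_product.2 ⟨h1.1, h2.1⟩, ?_⟩
    rintro ⟨i', j'⟩ hij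
    have hij' := Finset.mem_product.1 hij
    rw [ht, ht]
    exact add_le_add (h1.2 i' hij'.1) (h2.2 j' hij'.2)

theorem image_add_prod (a : ι → ℝ × ℝ) (b : κ → ℝ × ℝ) (s : Set ι) (t : Set κ) :
    (fun i : ι × κ => a i.1 + b i.2) '' s ×ˢ t = a '' s + b '' t := by
  ext p
  constructor
  · rintro ⟨⟨i, j⟩, ⟨hi, hj⟩, rfl⟩
    exact Set.add_mem_add (Set.mem_image_of_mem a hi) (Set.mem_image_of_mem b hj)
  · rintro ⟨_, ⟨i, hi, rfl⟩, _, ⟨j, hj, rfl⟩, rfl⟩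
    exact ⟨(i, j), ⟨hi, hj⟩, rfl⟩

theorem cell_mul (h : MaxAffine ι) (k : MaxAffine κ) (x : ℝ × ℝ) :
    (h.mul k).cell x = h.cell x + k.cell x := by
  rw [cell, cell, cell, ← convexHull_add, active_mul, ← image_add_prod]; rfl

theorem hull_mul (h : MaxAffine ι) (k : MaxAffine κ) : (h.mul k).hull = h.hull + k.hull := by
  rw [hull, hull, hull, ← convexHull_add, ← image_add_prod, ← Finset.coe_product]; rfl

/-- The translate of the family by `u`. -/
def translate (h : MaxAffine ι) (u : ℝ × ℝ) : MaxAffine ι where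
  support := h.support
  nonempty := h.nonempty
  slope := h.slope
  const := fun i => h.const i - planeDot (h.slope i) u

theorem term_translate (h : MaxAffine ι) (u : ℝ × ℝ) (i : ι) (x : ℝ × ℝ) :
    (h.translate u).term i x = h.term i (x - u) := by
  rw [term, term, planeDot_sub_right]; simp only [translate]; ring

theorem active_translate (h : MaxAffine ι) (u x : ℝ × ℝ) :
    (h.translate u).active x = h.active (x - u) := by
  simp only [active, term_translate]; rfl

theorem cell_translate (h : MaxAffine ι) (u x : ℝ × ℝ) :
    (h.translate u).cell x = h.cell (x - u) := by
  rw [cell, cell, active_translate]; rfl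

/-- The mixed areas of the cells of two families add up to the mixed area of the hulls. -/
theorem exists_sum_mixedArea (h : MaxAffine ι) (k : MaxAffine κ) : ∃ X : Finset (ℝ × ℝ),
    (∀ x, mixedArea (h.cell x) (k.cell x) ≠ 0 → x ∈ X) ∧
      ∑ x ∈ X, mixedArea (h.cell x) (k.cell x) = mixedArea h.hull k.hull := by
  -- One index set serving the tilings of `h`, of `k` and of their product, so that the three area
  -- formulas can be subtracted term by term.
  let X := h.finite_volume_cell_ne_zero.toFinset ∪ k.finite_volume_cell_ne_zero.toFinset ∪
    (h.mul k).finite_volume_cell_ne_zero.toFinset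
  have hX : ∀ x, x ∈ X ↔ (volume (h.cell x) ≠ 0 ∨ volume (k.cell x) ≠ 0) ∨
      volume ((h.mul k).cell x) ≠ 0 := by
    intro x; simp [X, or_assoc]
  refine ⟨X, fun x hx => ?_, ?_⟩
  · by_contra hn
    rw [hX] at hn
    push Not at hn
    apply hx
    rw [mixedArea, ← cell_mul, measureReal_def, measureReal_def, measureReal_def, hn.1.1, hn.1.2,
      hn.2]
    simp
  · simp only [mixedArea, Finset.sum_sub_distrib]
    rw [← hull_mul, h.volume_hull X fun x hx => (hX x).2 (Or.inl (Or.inl hx)),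
      k.volume_hull X fun x hx => (hX x).2 (Or.inl (Or.inr hx)),
      (h.mul k).volume_hull X fun x hx => (hX x).2 (Or.inr hx)]
    simp only [cell_mul]

end MaxAffine

end Planar

/-! ### Local conservation of mixed area under small translations. -/

section Planar

open MeasureTheory
open scoped Pointwise

/-- The determinant of two plane vectors. -/
def planeCross (a b : ℝ × ℝ) : ℝ := a.1 * b.2 - a.2 * b.1

theorem mixedArea_comm (P Q : Set (ℝ × ℝ)) : mixedArea P Q = mixedArea Q P := by
  rw [mixedArea, mixedArea, add_comm P Q]; ring

theorem measureReal_singleton_add (p : ℝ × ℝ) (Q : Set (ℝ × ℝ)) :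
    volume.real ({p} + Q) = volume.real Q := by
  rw [Set.singleton_add, Set.image_add_left, measureReal_def, measure_preimage_add, measureReal_def]

theorem mixedArea_singleton_left (p : ℝ × ℝ) (Q : Set (ℝ × ℝ)) : mixedArea {p} Q = 0 := by
  rw [mixedArea, measureReal_singleton_add, measureReal_def volume {p}, measure_singleton]; simp

theorem mixedArea_singleton_add_left (p : ℝ × ℝ) (P Q : Set (ℝ × ℝ)) :
    mixedArea ({p} + P) Q = mixedArea P Q := by
  rw [mixedArea, mixedArea, measureReal_singleton_add, add_assoc, measureReal_singleton_add]

theorem convex_planeDot_eq (x : ℝ × ℝ) (c : ℝ) : Convex ℝ {p | planeDot p x = c} := by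
  refine convex_hyperplane (f := fun p => planeDot p x) ?_ c
  constructor
  · intro p q; simp only [planeDot, Prod.fst_add, Prod.snd_add]; ring
  · intro t p; simp only [planeDot, Prod.smul_fst, Prod.smul_snd, smul_eq_mul]; ring

theorem measureReal_eq_zero_of_subset_line {w : ℝ × ℝ} (hw : w ≠ 0) {c : ℝ} {P : Set (ℝ × ℝ)}
    (hP : P ⊆ {p | planeDot p w = c}) : volume.real P = 0 := by
  rw [measureReal_def, measure_mono_null hP (volume_line_eq_zero hw c)]; rfl

theorem mixedArea_eq_zero_of_subset_line {w : ℝ × ℝ} (hw : w ≠ 0) {c d : ℝ} {P Q : Set (ℝ × ℝ)}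
    (hP : P ⊆ {p | planeDot p w = c}) (hQ : Q ⊆ {p | planeDot p w = d}) : mixedArea P Q = 0 := by
  have : P + Q ⊆ {p | planeDot p w = c + d} := by
    rintro _ ⟨p, hp, q, hq, rfl⟩
    have h1 : planeDot p w = c := hP hp
    have h2 : planeDot q w = d := hQ hq
    change planeDot (p + q) w = c + d
    rw [← h1, ← h2]; simp only [planeDot, Prod.fst_add, Prod.snd_add]; ring
  rw [mixedArea, measureReal_eq_zero_of_subset_line hw this, measureReal_eq_zero_of_subset_line hw hP,
    measureReal_eq_zero_of_subset_line hw hQ]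
  simp

theorem convexHull_subset_line {A : Set (ℝ × ℝ)} {w : ℝ × ℝ} {a : ℝ × ℝ}
    (h : ∀ a' ∈ A, planeCross w (a' - a) = 0) :
    convexHull ℝ A ⊆ {p | planeDot p (-w.2, w.1) = planeDot a (-w.2, w.1)} := by
  refine convexHull_min (fun p hp => ?_) (convex_planeDot_eq _ _)
  have := h p hp
  simp only [planeCross, Prod.fst_sub, Prod.snd_sub] at this
  change planeDot _ _ = planeDot _ _
  simp only [planeDot]; linarith

/-- Either one set is a point, or all differences in both sets are parallel to one direction; then
both hulls and their sum lie on parallel lines and have no area. -/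
theorem mixedArea_convexHull_eq_zero {A B : Set (ℝ × ℝ)} (hA : A.Nonempty) (hB : B.Nonempty)
    (h : ∀ a ∈ A, ∀ a' ∈ A, ∀ b ∈ B, ∀ b' ∈ B, planeCross (a - a') (b - b') = 0) :
    mixedArea (convexHull ℝ A) (convexHull ℝ B) = 0 := by
  obtain ⟨b₀, hb₀⟩ := hB
  obtain ⟨a₀, ha₀⟩ := hA
  by_cases hs : A.Subsingleton
  · rw [hs.eq_singleton_of_mem ha₀, convexHull_singleton, mixedArea_singleton_left]
  by_cases ht : B.Subsingleton
  · rw [ht.eq_singleton_of_mem hb₀, convexHull_singleton, mixedArea_comm, mixedArea_singleton_left]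
  obtain ⟨a, ha, a', ha', hne⟩ := Set.not_subsingleton_iff.1 hs
  obtain ⟨b, hb, b', hb', hne'⟩ := Set.not_subsingleton_iff.1 ht
  have hw : a - a' ≠ 0 := sub_ne_zero.2 hne
  have hw' : b - b' ≠ 0 := sub_ne_zero.2 hne'
  have hn : ((-(a - a').2, (a - a').1) : ℝ × ℝ) ≠ 0 := by
    intro h0
    rw [Prod.mk_eq_zero, neg_eq_zero] at h0
    exact hw (Prod.ext h0.2 h0.1)
  refine mixedArea_eq_zero_of_subset_line hn (convexHull_subset_line (a := a₀) fun c hc => ?_)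
    (convexHull_subset_line (a := b₀) fun c hc => h _ ha _ ha' _ hc _ hb₀)
  have h1 := h _ ha _ ha' _ hb _ hb'
  have h2 := h _ hc _ ha₀ _ hb _ hb'
  generalize a - a' = w at *
  generalize c - a₀ = z at *
  generalize b - b' = w' at *
  simp only [planeCross] at *
  -- If `w` and `z` were independent, `w'`, being parallel to both, would vanish.
  by_contra h3
  apply hw'
  ext
  · rw [Prod.fst_zero]; exact (mul_eq_zero.1 (show (w.1 * z.2 - w.2 * z.1) * w'.1 = 0 by
      linear_combination z.1 * h1 - w.1 * h2)).resolve_left h3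
  · rw [Prod.snd_zero]; exact (mul_eq_zero.1 (show (w.1 * z.2 - w.2 * z.1) * w'.2 = 0 by
      linear_combination z.2 * h1 - w.2 * h2)).resolve_left h3

/-- The common point of the lines with equations `a · x = α` and `b · x = β`. -/
noncomputable def lineMeet (a b : ℝ × ℝ) (α β : ℝ) : ℝ × ℝ :=
  ((α * b.2 - β * a.2) / planeCross a b, (a.1 * β - b.1 * α) / planeCross a b)

theorem eq_lineMeet {a b x : ℝ × ℝ} {α β : ℝ} (hab : planeCross a b ≠ 0) (ha : planeDot a x = α)
    (hb : planeDot b x = β) : x = lineMeet a b α β := by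
  subst ha hb
  ext
  · rw [lineMeet, eq_div_iff hab]; simp only [planeCross, planeDot]; ring
  · rw [lineMeet, eq_div_iff hab]; simp only [planeCross, planeDot]; ring

theorem Finset.exists_pos_forall {α : Type*} (X : Finset α) {P : α → ℝ → Prop}
    (h : ∀ x ∈ X, ∃ r > 0, P x r) (hP : ∀ x r s, 0 < s → s ≤ r → P x r → P x s) :
    ∃ r > 0, ∀ x ∈ X, P x r := by
  classical
  induction X using Finset.induction_on with
  | empty => exact ⟨1, one_pos, by simp⟩
  | insert a X _ ih =>
    obtain ⟨r, hr, h1⟩ := ih fun x hx => h x (Finset.mem_insert_of_mem hx)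
    obtain ⟨s, hs, h2⟩ := h a (Finset.mem_insert_self a X)
    refine ⟨min r s, lt_min hr hs, fun x hx => ?_⟩
    rcases Finset.mem_insert.1 hx with rfl | hx
    · exact hP _ _ _ (lt_min hr hs) (min_le_right _ _) h2
    · exact hP _ _ _ (lt_min hr hs) (min_le_left _ _) (h1 x hx)

theorem Finset.sum_eq_sum_of_support {α M : Type*} [AddCommMonoid M] {f : α → M} {A B : Finset α}
    (hA : ∀ x, f x ≠ 0 → x ∈ A) (hB : ∀ x, f x ≠ 0 → x ∈ B) : ∑ x ∈ A, f x = ∑ x ∈ B, f x := by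
  rw [← finsum_eq_sum_of_support_subset f hA, finsum_eq_sum_of_support_subset f hB]

namespace MaxAffine

variable {ι κ : Type*}

/-- The members of the family that are maximal at `x`. -/
noncomputable def restrict (h : MaxAffine ι) (x : ℝ × ℝ) : MaxAffine ι where
  support := (h.finite_active x).toFinset
  nonempty := by simpa using h.active_nonempty x
  slope := h.slope
  const := h.const

theorem hull_restrict (h : MaxAffine ι) (x : ℝ × ℝ) : (h.restrict x).hull = h.cell x := by
  rw [hull, cell, restrict, Set.Finite.coe_toFinset]

/-- Members inactive at `x` stay strictly below the active ones nearby, so the restricted family is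
the germ of `h` at `x`. -/
theorem eventually_active_restrict (h : MaxAffine ι) (x : ℝ × ℝ) :
    ∀ᶠ y in 𝓝 x, (h.restrict x).active y = h.active y := by
  filter_upwards [h.eventually_term_le x, h.active_subset_of_nhds x] with y h1 h2
  ext i
  constructor
  · rintro ⟨h3, h4⟩
    have h3' : i ∈ h.active x := by simpa [restrict] using h3
    refine ⟨h3'.1, fun j hj => ?_⟩
    by_cases hjx : j ∈ h.active x
    · exact h4 j (by simpa [restrict] using hjx)
    · exact (h1 j hj hjx i h3').le
  · intro hi
    refine ⟨by simpa [restrict] using h2 hi, fun j hj => ?_⟩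
    exact hi.2 j (h.active_subset x (by simpa [restrict] using hj))

/-- The mixed area of the cells at `x` of the translates of `h` and `k` by the components
of `p`. -/
noncomputable def shiftedMixedArea (h : MaxAffine ι) (k : MaxAffine κ) (p : (ℝ × ℝ) × (ℝ × ℝ))
    (x : ℝ × ℝ) : ℝ := mixedArea (h.cell (x - p.1)) (k.cell (x - p.2))

/-- The intersection of the line on which the members `q.1` of `h`, shifted by `p.1`, agree with
the line on which the members `q.2` of `k`, shifted by `p.2`, agree. -/
noncomputable def tiePoint (h : MaxAffine ι) (k : MaxAffine κ) (q : (ι × ι) × (κ × κ))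
    (p : (ℝ × ℝ) × (ℝ × ℝ)) : ℝ × ℝ :=
  lineMeet (h.slope q.1.1 - h.slope q.1.2) (k.slope q.2.1 - k.slope q.2.2)
    (h.const q.1.2 - h.const q.1.1 + planeDot (h.slope q.1.1 - h.slope q.1.2) p.1)
    (k.const q.2.2 - k.const q.2.1 + planeDot (k.slope q.2.1 - k.slope q.2.2) p.2)

theorem continuous_tiePoint (h : MaxAffine ι) (k : MaxAffine κ) (q : (ι × ι) × (κ × κ)) :
    Continuous (h.tiePoint k q) := by
  unfold tiePoint lineMeet planeDot
  fun_prop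

theorem planeDot_slope_sub {h : MaxAffine ι} {i j : ι} {x u : ℝ × ℝ} (hi : i ∈ h.active (x - u))
    (hj : j ∈ h.active (x - u)) : planeDot (h.slope i - h.slope j) x =
      h.const j - h.const i + planeDot (h.slope i - h.slope j) u := by
  have h1 := hi.2 j hj.1
  have h2 := hj.2 i hi.1
  simp only [term, planeDot, Prod.fst_sub, Prod.snd_sub] at *
  linarith

theorem eq_tiePoint {h : MaxAffine ι} {k : MaxAffine κ} {q : (ι × ι) × (κ × κ)}
    {p : (ℝ × ℝ) × (ℝ × ℝ)} {x : ℝ × ℝ}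
    (hq : planeCross (h.slope q.1.1 - h.slope q.1.2) (k.slope q.2.1 - k.slope q.2.2) ≠ 0)
    (h1 : q.1.1 ∈ h.active (x - p.1)) (h2 : q.1.2 ∈ h.active (x - p.1))
    (h3 : q.2.1 ∈ k.active (x - p.2)) (h4 : q.2.2 ∈ k.active (x - p.2)) :
    x = h.tiePoint k q p :=
  eq_lineMeet hq (planeDot_slope_sub h1 h2) (planeDot_slope_sub h3 h4)

/-- Nonzero mixed area needs non-parallel slope differences of active members. By `eq_tiePoint`
these pin down `x`, so there are finitely many candidates for `x`, each moving continuously with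
`p`. -/
theorem exists_active_of_shiftedMixedArea_ne_zero {h : MaxAffine ι} {k : MaxAffine κ}
    {p : (ℝ × ℝ) × (ℝ × ℝ)} {x : ℝ × ℝ} (hx : h.shiftedMixedArea k p x ≠ 0) :
    ∃ q : (ι × ι) × (κ × κ),
      planeCross (h.slope q.1.1 - h.slope q.1.2) (k.slope q.2.1 - k.slope q.2.2) ≠ 0 ∧
      q.1.1 ∈ h.active (x - p.1) ∧ q.1.2 ∈ h.active (x - p.1) ∧
      q.2.1 ∈ k.active (x - p.2) ∧ q.2.2 ∈ k.active (x - p.2) := by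
  by_contra! hn
  apply hx
  refine mixedArea_convexHull_eq_zero ((h.active_nonempty _).image _)
    ((k.active_nonempty _).image _) ?_
  rintro _ ⟨i, hi, rfl⟩ _ ⟨i', hi', rfl⟩ _ ⟨j, hj, rfl⟩ _ ⟨j', hj', rfl⟩
  by_contra h0
  exact hn ((i, i'), (j, j')) h0 hi hi' hj hj'

/-- Under small translations, the mixed areas of the cells near a point of intersection add up
to the mixed area of the cells at this point. -/
theorem exists_sum_shiftedMixedArea (h : MaxAffine ι) (k : MaxAffine κ) :
    ∃ X : Finset (ℝ × ℝ), ∃ r > 0, (∀ x ∈ X, ∀ y ∈ X, x ≠ y → 2 * r ≤ dist x y) ∧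
      ∀ ε, 0 < ε → ε ≤ r → ∀ᶠ p in 𝓝 (0 : (ℝ × ℝ) × (ℝ × ℝ)),
        (∀ x, h.shiftedMixedArea k p x ≠ 0 → ∃ y ∈ X, dist x y < ε) ∧
        ∀ y ∈ X, ∀ Z : Finset (ℝ × ℝ), (∀ x, h.shiftedMixedArea k p x ≠ 0 → x ∈ Z) →
          ∑ x ∈ Z with dist x y < ε, h.shiftedMixedArea k p x = mixedArea (h.cell y) (k.cell y) := by
  classical
  let Q : Finset ((ι × ι) × (κ × κ)) :=
    (h.support ×ˢ h.support) ×ˢ (k.support ×ˢ k.support)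
  -- All possible limit positions. A quadruple with parallel slope differences only contributes the
  -- point `(0, 0)`, through division by zero; the local count holds there as well.
  let X : Finset (ℝ × ℝ) := Q.image fun q => h.tiePoint k q 0
  -- The factor 2 leaves room for a point within `ε` of a point of `X`, displaced again by a shift
  -- of norm less than `ε`.
  obtain ⟨r₁, hr₁, hX₁⟩ := X.exists_pos_forall (P := fun x r => ∀ y, dist y x < 2 * r →
      (h.restrict x).active y = h.active y ∧ (k.restrict x).active y = k.active y) (by
    intro x _
    obtain ⟨s, hs, h1⟩ := Metric.eventually_nhds_iff.1
      ((h.eventually_active_restrict x).and (k.eventually_active_restrict x))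
    exact ⟨s / 2, by linarith, fun y hy => h1 (by linarith)⟩)
    (fun x r s _ hsr h1 y hy => h1 y (by linarith))
  obtain ⟨r₂, hr₂, hX₂⟩ := (X ×ˢ X).exists_pos_forall (P := fun x r => x.1 ≠ x.2 →
      2 * r ≤ dist x.1 x.2) (by
    rintro ⟨x, y⟩ _
    by_cases hxy : x = y
    · exact ⟨1, one_pos, fun h => absurd hxy h⟩
    · exact ⟨dist x y / 2, by have := dist_pos.2 hxy; linarith, fun _ => by simp; linarith⟩)
    (fun x r s _ hsr h1 hne => by linarith [h1 hne])
  refine ⟨X, min r₁ r₂, lt_min hr₁ hr₂, fun x hx y hy hxy =>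
    (by linarith [min_le_right r₁ r₂] : 2 * min r₁ r₂ ≤ 2 * r₂).trans
      (hX₂ (x, y) (Finset.mk_mem_product hx hy) hxy), ?_⟩
  intro ε hε hεr
  have hεr₁ : ε ≤ r₁ := hεr.trans (min_le_left _ _)
  have e1 : ∀ᶠ p in 𝓝 (0 : (ℝ × ℝ) × (ℝ × ℝ)), ∀ q ∈ Q,
      dist (h.tiePoint k q p) (h.tiePoint k q 0) < ε := by
    rw [Filter.eventually_all_finset]
    exact fun q _ => (h.continuous_tiePoint k q).continuousAt.eventually (Metric.ball_mem_nhds _ hε)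
  have e2 : ∀ᶠ p in 𝓝 (0 : (ℝ × ℝ) × (ℝ × ℝ)), dist p 0 < ε := Metric.ball_mem_nhds _ hε
  filter_upwards [e1, e2] with p hp1 hp2
  rw [dist_zero_right, Prod.norm_def, max_lt_iff] at hp2
  refine ⟨fun x hx => ?_, fun y hy Z hZ => ?_⟩
  · obtain ⟨q, hq, h1, h2, h3, h4⟩ := exists_active_of_shiftedMixedArea_ne_zero hx
    have hqQ : q ∈ Q := Finset.mem_product.2
      ⟨Finset.mem_product.2 ⟨h1.1, h2.1⟩, Finset.mem_product.2 ⟨h3.1, h4.1⟩⟩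
    refine ⟨_, Finset.mem_image_of_mem _ hqQ, ?_⟩
    conv_lhs => rw [eq_tiePoint hq h1 h2 h3 h4]
    exact hp1 q hqQ
  · have hloc : ∀ x, dist x y < ε → h.shiftedMixedArea k p x =
        (h.restrict y).shiftedMixedArea (k.restrict y) p x := by
      intro x hx
      have hd : ∀ u : ℝ × ℝ, ‖u‖ < ε → dist (x - u) y < 2 * r₁ := by
        intro u hu
        calc dist (x - u) y ≤ dist (x - u) x + dist x y := dist_triangle _ _ _
          _ < 2 * r₁ := by rw [dist_eq_norm (x - u) x, sub_sub_cancel_left, norm_neg]; linarith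
      rw [shiftedMixedArea, shiftedMixedArea, cell, cell, cell, cell, (hX₁ y hy _ (hd _ hp2.1)).1,
        (hX₁ y hy _ (hd _ hp2.2)).2]
      rfl
    -- A contributing point of the restricted families is a tie point of members active at `y`; for
    -- zero shift this tie point is `y` itself.
    have hnear : ∀ x, (h.restrict y).shiftedMixedArea (k.restrict y) p x ≠ 0 → dist x y < ε := by
      intro x hx
      obtain ⟨q, hq, h1, h2, h3, h4⟩ := exists_active_of_shiftedMixedArea_ne_zero hx
      have h1' : q.1.1 ∈ h.active y := by simpa [restrict] using h1.1
      have h2' : q.1.2 ∈ h.active y := by simpa [restrict] using h2.1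
      have h3' : q.2.1 ∈ k.active y := by simpa [restrict] using h3.1
      have h4' : q.2.2 ∈ k.active y := by simpa [restrict] using h4.1
      have hy0 : y = h.tiePoint k q 0 :=
        eq_tiePoint hq (by simpa using h1') (by simpa using h2') (by simpa using h3')
          (by simpa using h4')
      have hx0 : x = h.tiePoint k q p :=
        eq_tiePoint (h := h.restrict y) (k := k.restrict y) hq h1 h2 h3 h4
      rw [hy0, hx0]
      exact hp1 q (Finset.mem_product.2
        ⟨Finset.mem_product.2 ⟨h1'.1, h2'.1⟩, Finset.mem_product.2 ⟨h3'.1, h4'.1⟩⟩)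
    -- The global count for the restricted families, whose hulls are the cells at `y` and are
    -- unaffected by translation.
    obtain ⟨W, hW, hsum⟩ :=
      exists_sum_mixedArea ((h.restrict y).translate p.1) ((k.restrict y).translate p.2)
    simp only [cell_translate] at hW hsum
    have hr : ∀ (l : MaxAffine ι) (u : ℝ × ℝ), (l.translate u).hull = l.hull := fun _ _ => rfl
    have hr' : ∀ (l : MaxAffine κ) (u : ℝ × ℝ), (l.translate u).hull = l.hull := fun _ _ => rfl
    rw [hr, hr', hull_restrict, hull_restrict] at hsum
    rw [← hsum, Finset.sum_congr rfl fun x hx => hloc x (Finset.mem_filter.1 hx).2]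
    refine Finset.sum_eq_sum_of_support (fun x hx => ?_) hW
    exact Finset.mem_filter.2 ⟨hZ x (by rwa [hloc x (hnear x hx)]), hnear x hx⟩

end MaxAffine

end Planar

/-! ### The mixed area of a convex set and a standard triangle. -/

section Planar

open MeasureTheory
open scoped Pointwise

theorem volume_real_interval_add {S : Set ℝ} (hS : IsCompact S) (hc : Convex ℝ S)
    (hne : S.Nonempty) {c : ℝ} (h0 : 0 ≤ c) :
    volume (S + Set.Icc 0 c) = volume S + ENNReal.ofReal c := by
  have h1 := eq_Icc_of_connected_compact ⟨hne, hc.isPreconnected⟩ hS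
  have hle : sInf S ≤ sSup S := by
    rw [h1] at hne; exact Set.nonempty_Icc.1 hne
  rw [h1, Set.Icc_add_Icc hle h0, Real.volume_Icc, Real.volume_Icc,
    ← ENNReal.ofReal_add (by linarith) h0]
  congr 1; ring

/-- Fubini: each nonempty horizontal slice is a compact interval and becomes longer by `c`, while
the empty slices stay empty. -/
theorem volume_add_horizontal_segment {X : Set (ℝ × ℝ)} (hX : IsCompact X) (hc : Convex ℝ X)
    {c : ℝ} (h0 : 0 ≤ c) :
    volume (X + Set.Icc 0 c ×ˢ {0}) = volume X + ENNReal.ofReal c * volume (Prod.snd '' X) := by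
  have hX' : IsCompact (X + Set.Icc (0 : ℝ) c ×ˢ {(0 : ℝ)}) :=
    hX.add (isCompact_Icc.prod isCompact_singleton)
  have hslice : ∀ t : ℝ, IsCompact ((fun s : ℝ => (s, t)) ⁻¹' X) := by
    intro t
    refine (Topology.IsClosedEmbedding.isCompact_preimage ?_ hX)
    exact Topology.IsClosedEmbedding.of_continuous_injective_isClosedMap (by fun_prop)
      (fun a b hab => (Prod.mk.inj hab).1) fun s hs => by
        have : (fun s : ℝ => (s, t)) '' s = s ×ˢ {t} := by
          rw [Set.prod_singleton]
        rw [this]; exact hs.prod isClosed_singleton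
  have hconv : ∀ t : ℝ, Convex ℝ ((fun s : ℝ => (s, t)) ⁻¹' X) := by
    intro t s hs s' hs' a b ha hb hab
    have := hc hs hs' ha hb hab
    simp only [Prod.smul_mk, Prod.mk_add_mk, smul_eq_mul, ← add_mul, hab, one_mul] at this
    exact this
  have hsnd : MeasurableSet (Prod.snd '' X) := (hX.image continuous_snd).measurableSet
  rw [Measure.volume_eq_prod, Measure.prod_apply_symm hX'.measurableSet,
    Measure.prod_apply_symm hX.measurableSet, ← lintegral_indicator_const hsnd,
    ← lintegral_add_right _ (measurable_const.indicator hsnd)]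
  refine lintegral_congr fun t => ?_
  have hadd : (fun s : ℝ => (s, t)) ⁻¹' (X + Set.Icc 0 c ×ˢ {0}) =
      (fun s : ℝ => (s, t)) ⁻¹' X + Set.Icc 0 c := by
    ext s
    constructor
    · rintro ⟨x, hx, y, ⟨hy, hy0⟩, hxy⟩
      have hy0' : y.2 = 0 := hy0
      have h1 : x.1 + y.1 = s := congrArg Prod.fst hxy
      have h2 : x.2 + y.2 = t := congrArg Prod.snd hxy
      rw [hy0', add_zero] at h2
      refine ⟨x.1, ?_, y.1, hy, h1⟩
      rw [Set.mem_preimage, ← h2]; exact hx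
    · rintro ⟨x, hx, y, hy, rfl⟩
      exact ⟨(x, t), hx, (y, 0), ⟨hy, rfl⟩, by simp⟩
  rw [hadd]
  by_cases ht : t ∈ Prod.snd '' X
  · obtain ⟨x, hx, rfl⟩ := ht
    rw [volume_real_interval_add (hslice _) (hconv _) ⟨x.1, hx⟩ h0,
      Set.indicator_of_mem (Set.mem_image_of_mem _ hx)]
  · have : (fun s : ℝ => (s, t)) ⁻¹' X = ∅ :=
      Set.eq_empty_of_forall_notMem fun s hs => ht ⟨_, hs, rfl⟩
    rw [this, Set.empty_add, Set.indicator_of_notMem ht]; simp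

/-- The points above the set `Q`, up to height `M`. -/
def truncatedEpigraph (M : ℝ) (Q : Set (ℝ × ℝ)) : Set (ℝ × ℝ) :=
  {x | x.2 ≤ M ∧ ∃ t, (x.1, t) ∈ Q ∧ t ≤ x.2}

theorem convex_truncatedEpigraph (M : ℝ) {Q : Set (ℝ × ℝ)} (hQ : Convex ℝ Q) :
    Convex ℝ (truncatedEpigraph M Q) := by
  rintro x ⟨hx, t, ht, htx⟩ y ⟨hy, t', ht', hty⟩ a b ha hb hab
  refine ⟨?_, a • t + b • t', ?_, ?_⟩
  · exact convex_Iic M hx hy ha hb hab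
  · have := hQ ht ht' ha hb hab
    simpa using this
  · simp only [Prod.snd_add, Prod.smul_snd, smul_eq_mul]
    nlinarith

theorem isCompact_truncatedEpigraph (M : ℝ) {Q : Set (ℝ × ℝ)} (hQ : IsCompact Q) :
    IsCompact (truncatedEpigraph M Q) := by
  obtain ⟨R, hR⟩ := (hQ.image continuous_snd).bddBelow
  -- With `R` a lower bound for the heights in `Q`, a vertical segment of length `M - R` reaches
  -- everything below the cut.
  have : truncatedEpigraph M Q =
      (Q + {(0 : ℝ)} ×ˢ Set.Icc (0 : ℝ) (M - R)) ∩ {x | x.2 ≤ M} := by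
    ext x
    constructor
    · rintro ⟨hx, t, ht, htx⟩
      have hRt : R ≤ t := hR ⟨_, ht, rfl⟩
      exact ⟨⟨_, ht, (0, x.2 - t), ⟨rfl, by linarith, by linarith⟩, by ext <;> simp⟩, hx⟩
    · rintro ⟨⟨y, hy, z, ⟨hz, hz1, -⟩, rfl⟩, hx⟩
      have hz' : z.1 = 0 := hz
      exact ⟨hx, y.2, by simpa [hz'] using hy, by simpa using hz1⟩
  rw [this]
  exact (hQ.add (isCompact_singleton.prod isCompact_Icc)).inter_right
    (isClosed_le continuous_snd continuous_const)

/-- The triangle with vertices `(0, 0)`, `(c, 0)`, `(0, c)`. -/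
def planeTriangle (c : ℝ) : Set (ℝ × ℝ) := {x | 0 ≤ x.1 ∧ 0 ≤ x.2 ∧ x.1 + x.2 ≤ c}

theorem convex_planeTriangle (c : ℝ) : Convex ℝ (planeTriangle c) := by
  rintro x ⟨h1, h2, h3⟩ y ⟨h4, h5, h6⟩ a b ha hb hab
  simp only [planeTriangle, Set.mem_ofPred_eq, Prod.fst_add, Prod.snd_add, Prod.smul_fst,
    Prod.smul_snd, smul_eq_mul]
  exact ⟨by positivity, by positivity, by nlinarith⟩

theorem isCompact_planeTriangle (c : ℝ) : IsCompact (planeTriangle c) := by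
  refine IsCompact.of_isClosed_subset (isCompact_Icc (a := ((0, 0) : ℝ × ℝ)) (b := (c, c))) ?_ ?_
  · exact (isClosed_le continuous_const continuous_fst).inter
      ((isClosed_le continuous_const continuous_snd).inter
        (isClosed_le (continuous_fst.add continuous_snd) continuous_const))
  · rintro x ⟨h1, h2, h3⟩
    exact ⟨⟨h1, h2⟩, ⟨by simp only; linarith, by simp only; linarith⟩⟩

/-- The upward extent of the triangle is absorbed by the epigraph, so only the bottom edge counts.
This reduces adding a triangle to adding a horizontal segment. -/
theorem truncatedEpigraph_add_planeTriangle (M : ℝ) (Q : Set (ℝ × ℝ)) (c : ℝ) :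
    truncatedEpigraph M (Q + planeTriangle c) = truncatedEpigraph M Q + Set.Icc 0 c ×ˢ {0} := by
  ext x
  constructor
  · rintro ⟨hx, t, ⟨q, hq, y, ⟨hy1, hy2, hy3⟩, hqy⟩, htx⟩
    have h1 : q.1 + y.1 = x.1 := congrArg Prod.fst hqy
    have h2 : q.2 + y.2 = t := congrArg Prod.snd hqy
    exact ⟨(q.1, x.2), ⟨hx, q.2, hq, by simp only; linarith⟩, (y.1, 0),
      ⟨⟨hy1, by simp only; linarith⟩, rfl⟩, by ext <;> simp [h1]⟩
  · rintro ⟨y, ⟨hy, t, ht, hty⟩, z, ⟨⟨hz1, hz2⟩, hz⟩, rfl⟩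
    have hz' : z.2 = 0 := hz
    have hs : (y + z).2 = y.2 := by simp [hz']
    rw [truncatedEpigraph, Set.mem_ofPred_eq, hs]
    exact ⟨hy, t, ⟨_, ht, (z.1, 0), ⟨hz1, le_rfl, by simpa using hz2⟩, by simp⟩, hty⟩

theorem volume_truncatedEpigraph_add_planeTriangle {M t₀ c : ℝ} {Q : Set (ℝ × ℝ)}
    (hQ : IsCompact Q) (hconv : Convex ℝ Q) (h0 : 0 ≤ c) (ht : IsLeast (Prod.snd '' Q) t₀)
    (hM : t₀ ≤ M) :
    volume.real (truncatedEpigraph M (Q + planeTriangle c)) =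
      volume.real (truncatedEpigraph M Q) + c * (M - t₀) := by
  have hcomp := isCompact_truncatedEpigraph M hQ
  have hsnd : Prod.snd '' truncatedEpigraph M Q = Set.Icc t₀ M := by
    ext t
    constructor
    · rintro ⟨x, ⟨hx, t', ht', htx⟩, rfl⟩
      exact ⟨(ht.2 ⟨_, ht', rfl⟩).trans htx, hx⟩
    · rintro ⟨h1, h2⟩
      obtain ⟨q, hq, hq'⟩ := ht.1
      exact ⟨(q.1, t), ⟨h2, q.2, hq, hq'.trans_le h1⟩, rfl⟩
  rw [truncatedEpigraph_add_planeTriangle, measureReal_def,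
    volume_add_horizontal_segment hcomp (convex_truncatedEpigraph M hconv) h0, hsnd,
    Real.volume_Icc, ENNReal.toReal_add hcomp.measure_lt_top.ne
      (ENNReal.mul_ne_top ENNReal.ofReal_ne_top ENNReal.ofReal_ne_top), ENNReal.toReal_mul,
    ENNReal.toReal_ofReal h0, ENNReal.toReal_ofReal (by linarith), measureReal_def]

theorem truncatedEpigraph_vertical_translate (M c : ℝ) (Q : Set (ℝ × ℝ)) :
    truncatedEpigraph M ({(0, c)} + Q) = {(0, c)} + truncatedEpigraph (M - c) Q := by
  ext x
  simp only [Set.singleton_add, Set.mem_image]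
  constructor
  · rintro ⟨hx, t, ⟨q, hq, hqt⟩, htx⟩
    have h1 : 0 + q.1 = x.1 := congrArg Prod.fst hqt
    have h2 : c + q.2 = t := congrArg Prod.snd hqt
    refine ⟨(x.1, x.2 - c), ⟨by simp only; linarith, q.2, ?_, by simp only; linarith⟩, by simp⟩
    rw [← h1, zero_add]; exact hq
  · rintro ⟨y, ⟨hy, t, ht, hty⟩, rfl⟩
    refine ⟨by simp only [Prod.snd_add]; linarith, c + t, ⟨_, ht, by simp⟩, by simpa using hty⟩

/-- A unimodular involution of the plane permuting the edge directions of the triangle. -/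
def planeFlip (x : ℝ × ℝ) : ℝ × ℝ := (x.1, -x.1 - x.2)

theorem planeFlip_planeFlip (x : ℝ × ℝ) : planeFlip (planeFlip x) = x := by
  ext <;> simp [planeFlip]

theorem planeFlip_add (x y : ℝ × ℝ) : planeFlip (x + y) = planeFlip x + planeFlip y := by
  ext <;> simp [planeFlip]; ring

theorem continuous_planeFlip : Continuous planeFlip := by unfold planeFlip; fun_prop

theorem image_planeFlip (Q : Set (ℝ × ℝ)) : planeFlip '' Q = planeFlip ⁻¹' Q :=
  congrFun (Set.image_eq_preimage_of_inverse planeFlip_planeFlip planeFlip_planeFlip) Q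

theorem convex_image_planeFlip {Q : Set (ℝ × ℝ)} (hQ : Convex ℝ Q) : Convex ℝ (planeFlip '' Q) := by
  refine hQ.is_linear_image ⟨planeFlip_add, fun t x => ?_⟩
  ext <;> simp [planeFlip]; ring

theorem volume_preimage_planeFlip {Q : Set (ℝ × ℝ)} (hQ : MeasurableSet Q) :
    volume.real (planeFlip ⁻¹' Q) = volume.real Q := by
  rw [measureReal_def, measureReal_def, Measure.volume_eq_prod,
    Measure.prod_apply (continuous_planeFlip.measurable hQ), Measure.prod_apply hQ]
  congr 1
  refine lintegral_congr fun s => ?_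
  have : Prod.mk s ⁻¹' (planeFlip ⁻¹' Q) = (fun t => -s - t) ⁻¹' (Prod.mk s ⁻¹' Q) := rfl
  rw [this]
  exact (Measure.measurePreserving_sub_left volume (-s)).measure_preimage
    (measurable_prodMk_left hQ).nullMeasurableSet

theorem image_planeFlip_planeTriangle (c : ℝ) :
    planeFlip '' planeTriangle c = {(0, -c)} + planeTriangle c := by
  rw [image_planeFlip, Set.singleton_add, Set.image_add_left]
  ext x
  simp only [planeTriangle, planeFlip, Set.mem_preimage, Set.mem_ofPred_eq, Prod.fst_add,
    Prod.snd_add, Prod.fst_neg, Prod.snd_neg]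
  constructor <;> rintro ⟨h1, h2, h3⟩ <;> exact ⟨by linarith, by linarith, by linarith⟩

theorem volume_trapezoid {α β m : ℝ} (hαβ : α ≤ β) (hm : 0 ≤ m + α) (n : ℝ) :
    volume.real {x : ℝ × ℝ | x.1 ∈ Set.Icc α β ∧ n - m - x.1 ≤ x.2 ∧ x.2 ≤ n} =
      m * (β - α) + (β ^ 2 - α ^ 2) / 2 := by
  have hmeas : MeasurableSet {x : ℝ × ℝ | x.1 ∈ Set.Icc α β ∧ n - m - x.1 ≤ x.2 ∧ x.2 ≤ n} :=
    (measurable_fst measurableSet_Icc).inter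
      ((measurableSet_le (f := fun x : ℝ × ℝ => n - m - x.1) (by fun_prop) measurable_snd).inter
        (measurableSet_le measurable_snd measurable_const))
  have hslice : ∀ s : ℝ, volume (Prod.mk s ⁻¹'
      {x : ℝ × ℝ | x.1 ∈ Set.Icc α β ∧ n - m - x.1 ≤ x.2 ∧ x.2 ≤ n}) =
      (Set.Icc α β).indicator (fun s => ENNReal.ofReal (m + s)) s := by
    intro s
    by_cases hs : s ∈ Set.Icc α β
    · rw [Set.indicator_of_mem hs]
      have : Prod.mk s ⁻¹' {x : ℝ × ℝ | x.1 ∈ Set.Icc α β ∧ n - m - x.1 ≤ x.2 ∧ x.2 ≤ n} =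
          Set.Icc (n - m - s) n := by
        ext t; exact ⟨fun h => h.2, fun h => ⟨hs, h⟩⟩
      rw [this, Real.volume_Icc]; congr 1; ring
    · rw [Set.indicator_of_notMem hs]
      have : Prod.mk s ⁻¹' {x : ℝ × ℝ | x.1 ∈ Set.Icc α β ∧ n - m - x.1 ≤ x.2 ∧ x.2 ≤ n} = ∅ :=
        Set.eq_empty_of_forall_notMem fun t h => hs h.1
      rw [this, measure_empty]
  rw [measureReal_def, Measure.volume_eq_prod, Measure.prod_apply hmeas]
  simp only [hslice]
  rw [lintegral_indicator measurableSet_Icc, ← ofReal_integral_eq_lintegral_ofReal,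
    ENNReal.toReal_ofReal, integral_Icc_eq_integral_Ioc, ← intervalIntegral.integral_of_le hαβ]
  · rw [intervalIntegral.integral_add (by simp) (by simp)]
    simp; ring
  · exact setIntegral_nonneg measurableSet_Icc fun s hs => by linarith [hs.1]
  · exact (by fun_prop : Continuous fun s : ℝ => m + s).continuousOn.integrableOn_Icc
  · exact (ae_restrict_iff' measurableSet_Icc).2 (Eventually.of_forall fun s hs => by
      simp only [Pi.zero_apply]; linarith [hs.1])

/-- Inclusion–exclusion. `Q` is the intersection of the region above it, cut off at height `M`, and
the region below it, cut off by the line `x.1 + x.2 = N`; their union is the trapezoid between these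
two lines over the projection of `Q`. The flip makes the lower region an epigraph too. -/
theorem volume_add_volume_trapezoid {Q : Set (ℝ × ℝ)} (hQ : IsCompact Q) (hconv : Convex ℝ Q)
    {M N α β : ℝ} (hM : ∀ x ∈ Q, x.2 ≤ M) (hN : ∀ x ∈ Q, N ≤ x.1 + x.2)
    (hfst : Prod.fst '' Q = Set.Icc α β) (hαβ : α ≤ β) :
    volume.real Q + ((M - N) * (β - α) + (β ^ 2 - α ^ 2) / 2) =
      volume.real (truncatedEpigraph M Q) +
        volume.real (truncatedEpigraph (-N) (planeFlip '' Q)) := by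
  have hc1 := isCompact_truncatedEpigraph M hQ
  have hc2 := isCompact_truncatedEpigraph (-N) (hQ.image continuous_planeFlip)
  have hlow : planeFlip ⁻¹' truncatedEpigraph (-N) (planeFlip '' Q) =
      {x | N ≤ x.1 + x.2 ∧ ∃ t, (x.1, t) ∈ Q ∧ x.2 ≤ t} := by
    ext x
    rw [image_planeFlip]
    constructor
    · rintro ⟨h1, t, ht, htx⟩
      simp only [planeFlip] at h1 htx
      exact ⟨by linarith, _, ht, by simp only [planeFlip]; linarith⟩
    · rintro ⟨h1, t, ht, htx⟩
      refine ⟨by simp only [planeFlip]; linarith, -x.1 - t, ?_, by simp only [planeFlip]; linarith⟩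
      simpa [planeFlip] using ht
  have hinter : truncatedEpigraph M Q ∩
      planeFlip ⁻¹' truncatedEpigraph (-N) (planeFlip '' Q) = Q := by
    rw [hlow]
    ext x
    constructor
    · rintro ⟨⟨-, t, ht, htx⟩, -, t', ht', htx'⟩
      have hv : Convex ℝ (Prod.mk x.1 ⁻¹' Q) := by
        intro s hs s' hs' a b ha hb hab
        have := hconv hs hs' ha hb hab
        simp only [Prod.smul_mk, Prod.mk_add_mk, smul_eq_mul, ← add_mul, hab, one_mul] at this
        exact this
      exact hv.ordConnected.out ht ht' ⟨htx, htx'⟩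
    · intro hx
      exact ⟨⟨hM x hx, x.2, hx, le_rfl⟩, hN x hx, x.2, hx, le_rfl⟩
  have hunion : truncatedEpigraph M Q ∪ planeFlip ⁻¹' truncatedEpigraph (-N) (planeFlip '' Q) =
      {x : ℝ × ℝ | x.1 ∈ Set.Icc α β ∧ M - (M - N) - x.1 ≤ x.2 ∧ x.2 ≤ M} := by
    rw [hlow, ← hfst]
    ext x
    constructor
    · rintro (⟨h1, t, ht, htx⟩ | ⟨h1, t, ht, htx⟩)
      · have := hN _ ht
        exact ⟨⟨_, ht, rfl⟩, by simp only at this; linarith, h1⟩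
      · exact ⟨⟨_, ht, rfl⟩, by linarith, htx.trans (hM _ ht)⟩
    · rintro ⟨⟨y, hy, hyx⟩, h1, h2⟩
      have hy' : (x.1, y.2) ∈ Q := by rw [← hyx]; exact hy
      rcases le_total y.2 x.2 with h3 | h3
      · exact Or.inl ⟨h2, _, hy', h3⟩
      · exact Or.inr ⟨by linarith, _, hy', h3⟩
  have hmα : 0 ≤ M - N + α := by
    have : α ∈ Prod.fst '' Q := by rw [hfst]; exact ⟨le_rfl, hαβ⟩
    obtain ⟨q, hq, rfl⟩ := this
    linarith [hM q hq, hN q hq]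
  have hmeas := continuous_planeFlip.measurable hc2.measurableSet
  have hfin : volume (planeFlip ⁻¹' truncatedEpigraph (-N) (planeFlip '' Q)) ≠ ⊤ := by
    rw [← image_planeFlip]; exact (hc2.image continuous_planeFlip).measure_lt_top.ne
  have := measureReal_union_add_inter (μ := volume) (s := truncatedEpigraph M Q) hmeas
    hc1.measure_lt_top.ne hfin
  rw [hinter, hunion, volume_trapezoid hαβ hmα, volume_preimage_planeFlip hc2.measurableSet] at this
  linarith

/-- Comparison of the decomposition `volume_add_volume_trapezoid` for `Q` and for the sum: both
epigraphs grow by `c` times their height, and the trapezoid is widened by `c`. -/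
theorem volume_add_planeTriangle {Q : Set (ℝ × ℝ)} (hQ : IsCompact Q) (hconv : Convex ℝ Q)
    {s₀ t₀ m c : ℝ} (h0 : 0 ≤ c) (hs : IsLeast (Prod.fst '' Q) s₀)
    (ht : IsLeast (Prod.snd '' Q) t₀)
    (hm : IsGreatest ((fun x : ℝ × ℝ => x.1 + x.2) '' Q) m) :
    volume.real (Q + planeTriangle c) = volume.real Q + c * (m - s₀ - t₀) + c ^ 2 / 2 := by
  have hne : Q.Nonempty := hs.1.imp fun x hx => hx.1
  obtain ⟨s₁, hs₁⟩ := (hQ.image continuous_fst).exists_isGreatest (hne.image _)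
  have hfst : Prod.fst '' Q = Set.Icc s₀ s₁ := by
    have h1 := eq_Icc_of_connected_compact
      ⟨hne.image Prod.fst, hconv.isPreconnected.image _ continuous_fst.continuousOn⟩
      (hQ.image continuous_fst)
    rwa [hs.csInf_eq, hs₁.csSup_eq] at h1
  have hs01 : s₀ ≤ s₁ := hs₁.2 hs.1
  have hfst' : Prod.fst '' (Q + planeTriangle c) = Set.Icc s₀ (s₁ + c) := by
    have h1 : Prod.fst '' (Q + planeTriangle c) =
        Prod.fst '' Q + Prod.fst '' planeTriangle c := Set.image_add (AddMonoidHom.fst ℝ ℝ)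
    have h2 : Prod.fst '' planeTriangle c = Set.Icc 0 c := by
      ext s
      constructor
      · rintro ⟨x, ⟨h1, h2, h3⟩, rfl⟩; exact ⟨h1, by linarith⟩
      · rintro ⟨h1, h2⟩; exact ⟨(s, 0), ⟨h1, le_rfl, by simpa using h2⟩, rfl⟩
    rw [h1, h2, hfst, Set.Icc_add_Icc hs01 h0, add_zero]
  have hK := hQ.add (isCompact_planeTriangle c)
  have hKconv := hconv.add (convex_planeTriangle c)
  obtain ⟨M, hM⟩ := (hK.image continuous_snd).bddAbove
  obtain ⟨N, hN⟩ := (hK.image (continuous_fst.add continuous_snd)).bddBelow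
  have hM' : ∀ x ∈ Q + planeTriangle c, x.2 ≤ M := fun x hx => hM ⟨x, hx, rfl⟩
  have hN' : ∀ x ∈ Q + planeTriangle c, N ≤ x.1 + x.2 := fun x hx => hN ⟨x, hx, rfl⟩
  have hsub : Q ⊆ Q + planeTriangle c := fun x hx =>
    ⟨x, hx, 0, ⟨le_rfl, le_rfl, by simpa using h0⟩, add_zero x⟩
  -- The flip moves the triangle down by `c`, so cutting the flipped sum at `-N` corresponds to
  -- cutting the flip of `Q` at `-(N - c)`.
  have e1 := volume_add_volume_trapezoid hQ hconv (M := M) (N := N - c) (fun x hx => hM' x (hsub hx))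
    (fun x hx => by linarith [hN' x (hsub hx)]) hfst hs01
  have e2 := volume_add_volume_trapezoid hK hKconv hM' hN' hfst' (by linarith)
  have hflip : planeFlip '' (Q + planeTriangle c) =
      {(0, -c)} + (planeFlip '' Q + planeTriangle c) := by
    have : planeFlip '' (Q + planeTriangle c) = planeFlip '' Q + planeFlip '' planeTriangle c :=
      Set.image_add (⟨⟨planeFlip, by ext <;> simp [planeFlip]⟩, planeFlip_add⟩ : ℝ × ℝ →+ ℝ × ℝ)
    rw [this, image_planeFlip_planeTriangle, add_left_comm]
  have hflipsnd : Prod.snd '' (planeFlip '' Q) = (fun x => -x) '' ((fun x => x.1 + x.2) '' Q) := by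
    rw [Set.image_image, Set.image_image]
    refine Set.image_congr fun x _ => ?_
    simp only [planeFlip]; ring
  have hleast : IsLeast (Prod.snd '' (planeFlip '' Q)) (-m) := by
    rw [hflipsnd]
    refine ⟨⟨m, hm.1, rfl⟩, ?_⟩
    rintro _ ⟨y, hy, rfl⟩
    exact neg_le_neg (hm.2 hy)
  obtain ⟨q, hq, hqt⟩ := ht.1
  have e3 := volume_truncatedEpigraph_add_planeTriangle hQ hconv h0 ht
    (M := M) (hqt ▸ hM' q (hsub hq))
  obtain ⟨q', hq', hqm⟩ := hm.1
  have e4 := volume_truncatedEpigraph_add_planeTriangle (hQ.image continuous_planeFlip)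
    (convex_image_planeFlip hconv) h0 hleast (M := -(N - c)) (by
      have := hN' q' (hsub hq'); simp only at hqm; linarith)
  rw [hflip, truncatedEpigraph_vertical_translate, measureReal_singleton_add,
    show -N - -c = -(N - c) by ring, e3, e4] at e2
  linarith

/-- The mixed area of a standard triangle and a convex set is the size of the triangle times the
size of the smallest circumscribed standard triangle of the set. -/
theorem mixedArea_planeTriangle {Q : Set (ℝ × ℝ)} (hQ : IsCompact Q) (hconv : Convex ℝ Q)
    {s₀ t₀ m c : ℝ} (h0 : 0 ≤ c) (hs : IsLeast (Prod.fst '' Q) s₀)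
    (ht : IsLeast (Prod.snd '' Q) t₀)
    (hm : IsGreatest ((fun x : ℝ × ℝ => x.1 + x.2) '' Q) m) :
    mixedArea (planeTriangle c) Q = c * (m - s₀ - t₀) := by
  have h1 := volume_add_planeTriangle hQ hconv h0 hs ht hm
  -- The one-point set yields the area `c ^ 2 / 2` of the triangle itself.
  have h2 := volume_add_planeTriangle (Q := {0}) (s₀ := 0) (t₀ := 0) (m := 0)
    isCompact_singleton (convex_singleton _) h0 (by simp) (by simp) (by simp)
  rw [measureReal_singleton_add, measureReal_def volume {0}, measure_singleton] at h2
  rw [mixedArea, add_comm, h1, h2]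
  simp

end Planar

/-! ### Mixed area of two segments, and lattice segments. -/

section Planar

open MeasureTheory
open scoped Pointwise

theorem segment_eq_singleton_add (p a : ℝ × ℝ) : segment ℝ p (p + a) = {p} + segment ℝ 0 a := by
  rw [Set.singleton_add, segment_eq_image, segment_eq_image, Set.image_image]
  refine Set.image_congr fun t _ => ?_
  rw [smul_zero, zero_add, smul_add, ← add_assoc, ← add_smul, sub_add_cancel, one_smul]

/-- The parallelogram is the image of the unit square under the linear map with columns `a` and `b`.
-/
theorem volume_segment_add_segment (a b : ℝ × ℝ) :
    volume.real (segment ℝ 0 a + segment ℝ 0 b) = |planeCross a b| := by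
  let L := Matrix.toLin (Module.Basis.finTwoProd ℝ) (Module.Basis.finTwoProd ℝ)
    !![a.1, b.1; a.2, b.2]
  have hL : ∀ x, L x = x.1 • a + x.2 • b := by
    intro x
    simp only [L, Matrix.toLin_finTwoProd, LinearMap.prod_apply]
    ext <;> simp [mul_comm]
  have himg : segment ℝ 0 a + segment ℝ 0 b = L '' (Set.Icc 0 1 ×ˢ Set.Icc 0 1) := by
    rw [segment_eq_image, segment_eq_image]
    ext p
    constructor
    · rintro ⟨_, ⟨s, hs, rfl⟩, _, ⟨t, ht, rfl⟩, rfl⟩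
      exact ⟨(s, t), ⟨hs, ht⟩, by rw [hL]; simp⟩
    · rintro ⟨⟨s, t⟩, ⟨hs, ht⟩, rfl⟩
      exact ⟨_, ⟨s, hs, rfl⟩, _, ⟨t, ht, rfl⟩, by rw [hL]; simp⟩
  have hdet : LinearMap.det L = planeCross a b := by
    rw [LinearMap.det_toLin, Matrix.det_fin_two_of, planeCross]; ring
  rw [himg, measureReal_def, Measure.addHaar_image_linearMap, hdet, Measure.volume_eq_prod,
    Measure.prod_prod, Real.volume_Icc]
  simp

theorem mixedArea_segment (p a q b : ℝ × ℝ) :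
    mixedArea (segment ℝ p (p + a)) (segment ℝ q (q + b)) = |planeCross a b| := by
  rw [segment_eq_singleton_add, segment_eq_singleton_add, mixedArea_singleton_add_left,
    mixedArea_comm, mixedArea_singleton_add_left, mixedArea_comm]
  have hline : ∀ a : ℝ × ℝ, a ≠ 0 → volume.real (segment ℝ 0 a) = 0 := by
    intro a ha
    have hn : ((-a.2, a.1) : ℝ × ℝ) ≠ 0 := by
      intro h0
      rw [Prod.mk_eq_zero, neg_eq_zero] at h0
      exact ha (Prod.ext h0.2 h0.1)
    refine measureReal_eq_zero_of_subset_line hn (c := 0) ?_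
    rw [segment_eq_image]
    rintro _ ⟨t, -, rfl⟩
    change planeDot _ _ = 0
    simp only [planeDot, smul_zero, zero_add, Prod.smul_fst, Prod.smul_snd, smul_eq_mul]; ring
  by_cases ha : a = 0
  · subst ha; rw [segment_same, mixedArea_singleton_left]; simp [planeCross]
  by_cases hb : b = 0
  · subst hb; rw [segment_same, mixedArea_comm, mixedArea_singleton_left]; simp [planeCross]
  rw [mixedArea, volume_segment_add_segment, hline a ha, hline b hb]; ring

theorem convexHull_image_eq_segment {α E : Type*} [AddCommGroup E] [Module ℝ E] {A : Set α}
    {e : α → E} {P W : E} {m : ℕ} (hm : 0 < m) (h : ∀ b ∈ A, ∃ j : ℕ, j ≤ m ∧ e b = P + (j : ℝ) • W)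
    (hl : ∃ a ∈ A, e a = P) (hr : ∃ a ∈ A, e a = P + (m : ℝ) • W) :
    convexHull ℝ (e '' A) = segment ℝ P (P + (m : ℝ) • W) := by
  apply subset_antisymm
  · refine convexHull_min ?_ (convex_segment _ _)
    rintro _ ⟨b, hb, rfl⟩
    obtain ⟨j, hj, he⟩ := h b hb
    have hm' : (0 : ℝ) < m := by exact_mod_cast hm
    rw [segment_eq_image']
    refine ⟨j / m, ⟨by positivity, (div_le_one hm').2 (by exact_mod_cast hj)⟩, ?_⟩
    simp only [add_sub_cancel_left]
    rw [he, smul_smul, div_mul_cancel₀ _ hm'.ne']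
  · obtain ⟨a, ha, hea⟩ := hl
    obtain ⟨a', ha', hea'⟩ := hr
    rw [← hea', ← hea]
    exact segment_subset_convexHull (Set.mem_image_of_mem e ha) (Set.mem_image_of_mem e ha')

/-- The set `A` of exponents consists of lattice points of the segment from `a` to `a + m • w`,
endpoints included, with `w` primitive. -/
structure IsLatticeSegment (A : Set (Fin 3 → ℤ)) (a w : Fin 3 → ℤ) (m : ℕ) : Prop where
  pos : 0 < m
  coprime : IsCoprime (w 0) (w 1)
  sum_eq_zero : w 0 + w 1 + w 2 = 0
  left_mem : a ∈ A
  right_mem : a + (m : ℤ) • w ∈ A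
  exists_eq : ∀ b ∈ A, ∃ j : ℕ, j ≤ m ∧ b = a + (j : ℤ) • w

/-- The determinant of the differences of three exponents, in the first two coordinates. -/
def expCross (a b c : Fin 3 → ℤ) : ℤ := (b 0 - a 0) * (c 1 - a 1) - (b 1 - a 1) * (c 0 - a 0)

/-- Dividing one nonzero difference by the gcd of its first two coordinates gives the primitive
vector; the third coordinate is determined by the constant coordinate sum. -/
theorem exists_isLatticeSegment {A : Set (Fin 3 → ℤ)} (hfin : A.Finite) (hA : ¬ A.Subsingleton)
    {k : ℤ} (hk : ∀ a ∈ A, a 0 + a 1 + a 2 = k)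
    (hcol : ∀ a ∈ A, ∀ b ∈ A, ∀ c ∈ A, expCross a b c = 0) :
    ∃ a w m, IsLatticeSegment A a w m := by
  obtain ⟨a₁, h₁, a₂, h₂, hne⟩ := Set.not_subsingleton_iff.1 hA
  have hz : a₂ 0 - a₁ 0 ≠ 0 ∨ a₂ 1 - a₁ 1 ≠ 0 := by
    by_contra! h
    apply hne
    have := hk a₁ h₁
    have := hk a₂ h₂
    ext i; fin_cases i
    · change a₁ 0 = a₂ 0; omega
    · change a₁ 1 = a₂ 1; omega
    · change a₁ 2 = a₂ 2; omega
  obtain ⟨w₀, w₁, g, hg, hw0, hw1, u, v, huv⟩ : ∃ w₀ w₁ g : ℤ, g ≠ 0 ∧ a₂ 0 - a₁ 0 = g * w₀ ∧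
      a₂ 1 - a₁ 1 = g * w₁ ∧ IsCoprime w₀ w₁ := by
    have hgpos : 0 < Int.gcd (a₂ 0 - a₁ 0) (a₂ 1 - a₁ 1) := Int.gcd_pos_iff.2 hz
    obtain ⟨p, q, hcop, hp, hq⟩ := Int.exists_gcd_one hgpos
    exact ⟨p, q, Int.gcd (a₂ 0 - a₁ 0) (a₂ 1 - a₁ 1), by exact_mod_cast hgpos.ne', by rw [mul_comm]; exact hp,
      by rw [mul_comm]; exact hq, Int.isCoprime_iff_gcd_eq_one.2 hcop⟩
  -- The Bézout coefficients of the primitive vector give an integral functional that reads off the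
  -- position along the line; its extremes on `A` are the endpoints.
  let pos : (Fin 3 → ℤ) → ℤ := fun b => u * (b 0 - a₁ 0) + v * (b 1 - a₁ 1)
  have hpos : ∀ b ∈ A, b 0 = a₁ 0 + pos b * w₀ ∧ b 1 = a₁ 1 + pos b * w₁ := by
    intro b hb
    have h := hcol a₁ h₁ a₂ h₂ b hb
    rw [expCross, hw0, hw1] at h
    have h' : w₀ * (b 1 - a₁ 1) = w₁ * (b 0 - a₁ 0) :=
      mul_left_cancel₀ hg (by linear_combination h)
    simp only [pos]
    constructor
    · linear_combination (a₁ 0 - b 0) * huv - v * h'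
    · linear_combination (a₁ 1 - b 1) * huv + u * h'
  obtain ⟨a, ha, hmin⟩ := hfin.exists_minimalFor pos A ⟨a₁, h₁⟩
  obtain ⟨a', ha', hmax⟩ := hfin.exists_maximalFor pos A ⟨a₁, h₁⟩
  have hmin' : ∀ b ∈ A, pos a ≤ pos b := fun b hb => by
    rcases le_total (pos a) (pos b) with h | h
    · exact h
    · exact hmin hb h
  have hmax' : ∀ b ∈ A, pos b ≤ pos a' := fun b hb => by
    rcases le_total (pos b) (pos a') with h | h
    · exact h
    · exact hmax hb h
  have heq : ∀ b ∈ A, b = a + (pos b - pos a) • ![w₀, w₁, -w₀ - w₁] := by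
    intro b hb
    have e1 := hpos b hb
    have e2 := hpos a ha
    have e3 := hk b hb
    have e4 := hk a ha
    ext i; fin_cases i
    · simp; linear_combination e1.1 - e2.1
    · simp; linear_combination e1.2 - e2.2
    · simp; linear_combination e3 - e4 - e1.1 + e2.1 - e1.2 + e2.2
  refine ⟨a, ![w₀, w₁, -w₀ - w₁], (pos a' - pos a).toNat, ?_, ⟨u, v, huv⟩, by simp, ha, ?_, ?_⟩
  · rw [Int.lt_toNat]
    have hle := hmin' a' ha'
    refine lt_of_le_of_ne (by simpa using hle) fun h0 => hne ?_
    have hp : ∀ b ∈ A, pos b - pos a = 0 := fun b hb => by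
      have := hmin' b hb; have := hmax' b hb
      simp only [Nat.cast_zero] at h0; omega
    rw [heq a₁ h₁, heq a₂ h₂, hp a₁ h₁, hp a₂ h₂]
  · rw [Int.toNat_of_nonneg (by linarith [hmin' a' ha']), ← heq a' ha']; exact ha'
  · intro b hb
    have := hmin' b hb
    have := hmax' b hb
    refine ⟨(pos b - pos a).toNat, by omega, ?_⟩
    rw [Int.toNat_of_nonneg (by omega)]; exact heq b hb

/-- Primitivity excludes lattice points between consecutive multiples of `w`: the Bézout functional
takes the value `θ * m` on the displacement, so this real parameter is an integer between `0` and
`m`. -/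
theorem IsLatticeSegment.ncard_lattice_points {A : Set (Fin 3 → ℤ)} {a w : Fin 3 → ℤ} {m : ℕ}
    (h : IsLatticeSegment A a w m) :
    {z : Fin 3 → ℤ | intVec z ∈ convexHull ℝ (intVec '' A)}.ncard = m + 1 := by
  have hvec : ∀ j : ℤ, intVec (a + j • w) = intVec a + (j : ℝ) • intVec w := by
    intro j; ext i; simp [intVec]
  have hseg : convexHull ℝ (intVec '' A) = segment ℝ (intVec a) (intVec a + (m : ℝ) • intVec w) := by
    refine convexHull_image_eq_segment h.pos (fun b hb => ?_) ⟨a, h.left_mem, rfl⟩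
      ⟨_, h.right_mem, by rw [hvec]; simp⟩
    obtain ⟨j, hj, rfl⟩ := h.exists_eq b hb
    exact ⟨j, hj, by rw [hvec]; simp⟩
  obtain ⟨u, v, huv⟩ := h.coprime
  have huv' : (u : ℝ) * w 0 + v * w 1 = 1 := by exact_mod_cast huv
  have hm : (0 : ℝ) < m := by exact_mod_cast h.pos
  have himg : {z : Fin 3 → ℤ | intVec z ∈ convexHull ℝ (intVec '' A)} =
      (fun j : ℕ => a + (j : ℤ) • w) '' (Finset.range (m + 1) : Set ℕ) := by
    rw [hseg, segment_eq_image']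
    ext z
    constructor
    · rintro ⟨θ, ⟨h0, h1⟩, hz⟩
      simp only [add_sub_cancel_left, smul_smul] at hz
      have hz' : ∀ i, (z i : ℝ) = a i + θ * m * w i := fun i => by
        have := congrFun hz i
        simp only [intVec, Pi.add_apply, Pi.smul_apply, smul_eq_mul] at this
        exact this.symm
      have hj : (((u * (z 0 - a 0) + v * (z 1 - a 1) : ℤ)) : ℝ) = θ * m := by
        push_cast
        rw [hz' 0, hz' 1]; linear_combination (θ * m) * huv'
      generalize u * (z 0 - a 0) + v * (z 1 - a 1) = j at hj
      have hj0 : 0 ≤ j := by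
        have : (0 : ℝ) ≤ j := by rw [hj]; positivity
        exact_mod_cast this
      have hjm : j ≤ m := by
        have : (j : ℝ) ≤ m := by rw [hj]; nlinarith
        exact_mod_cast this
      refine ⟨j.toNat, by simp; omega, ?_⟩
      simp only [Int.toNat_of_nonneg hj0]
      ext i
      have := hz' i
      rw [← hj] at this
      simp only [Pi.add_apply, Pi.smul_apply, smul_eq_mul]
      exact_mod_cast this.symm
    · rintro ⟨j, hj, rfl⟩
      have hj' : j ≤ m := by simpa [Nat.lt_succ_iff] using hj
      refine ⟨j / m, ⟨by positivity, (div_le_one hm).2 (by exact_mod_cast hj')⟩, ?_⟩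
      simp only [add_sub_cancel_left, smul_smul, div_mul_cancel₀ _ hm.ne', hvec, Int.cast_natCast]
  rw [himg, Set.ncard_image_of_injective, Set.ncard_coe_finset, Finset.card_range]
  intro i j hij
  have h0 : (i : ℤ) * w 0 = j * w 0 := by simpa using congrFun hij 0
  have h1 : (i : ℤ) * w 1 = j * w 1 := by simpa using congrFun hij 1
  have : (i : ℤ) = j := by linear_combination (j - i : ℤ) * huv + u * h0 + v * h1
  exact_mod_cast this

end Planar

/-! ### From homogeneous polynomials to the plane: multiplicities as mixed areas. -/

section PlaneCurves

open MeasureTheory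
open scoped Pointwise

/-- Affine coordinates of the point of the tropical projective plane represented by `x`. -/
def planePoint (x : Fin 3 → ℝ) : ℝ × ℝ := (x 0 - x 2, x 1 - x 2)

theorem continuous_planePoint : Continuous planePoint := by unfold planePoint; fun_prop

namespace TropPoly

/-- The family of affine functions on the plane that a homogeneous tropical polynomial in three
variables induces in affine coordinates. -/
def planar (f : TropPoly 3) : MaxAffine (Fin 3 → ℤ) where
  support := f.support
  nonempty := f.nonempty
  slope := fun a => ((a 0 : ℝ), (a 1 : ℝ))
  const := f.coeff

variable {f g : TropPoly 3} {k l : ℤ}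

theorem IsHomogeneous.sum_eq (hf : f.IsHomogeneous k) {a : Fin 3 → ℤ} (ha : a ∈ f.support) :
    a 0 + a 1 + a 2 = k := by
  have := hf a ha
  rwa [Fin.sum_univ_three] at this

theorem IsHomogeneous.translate (hf : f.IsHomogeneous k) (u : Fin 3 → ℝ) :
    (f.translate u).IsHomogeneous k := hf

/-- By homogeneity, passing to affine coordinates changes all monomials by the same amount, so
maximality can be tested in the plane. -/
theorem monomial_eq_term (hf : f.IsHomogeneous k) {a : Fin 3 → ℤ} (ha : a ∈ f.support)
    (x : Fin 3 → ℝ) : f.monomial a x = f.planar.term a (planePoint x) + k * x 2 := by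
  have h : ((a 0 : ℝ) + a 1 + a 2) = k := by exact_mod_cast hf.sum_eq ha
  rw [monomial, Fin.sum_univ_three, MaxAffine.term, planar, planeDot, planePoint, ← h]
  ring

theorem mem_active_iff (hf : f.IsHomogeneous k) (a : Fin 3 → ℤ) (x : Fin 3 → ℝ) :
    a ∈ f.support ∧ f.monomial a x = f.eval x ↔ a ∈ f.planar.active (planePoint x) := by
  constructor
  · rintro ⟨h1, h2⟩
    refine ⟨h1, fun b hb => ?_⟩
    have : f.monomial b x ≤ f.eval x := Finset.le_sup' (fun a => f.monomial a x) hb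
    rw [← h2, monomial_eq_term hf h1, monomial_eq_term hf hb] at this
    linarith
  · rintro ⟨h1, h2⟩
    refine ⟨h1, le_antisymm (Finset.le_sup' (fun a => f.monomial a x) h1)
      (Finset.sup'_le _ _ fun b hb => ?_)⟩
    have := h2 b hb
    rw [monomial_eq_term hf h1, monomial_eq_term hf hb]
    linarith

theorem dualCell_eq (hf : f.IsHomogeneous k) (x : Fin 3 → ℝ) :
    f.dualCell x = convexHull ℝ (intVec '' f.planar.active (planePoint x)) := by
  simp only [dualCell, mem_active_iff hf]; rfl

/-- The two families differ by a constant common to all members, `k * u 2`, which does not affect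
which of them are maximal. -/
theorem active_planar_translate (hf : f.IsHomogeneous k) (u : Fin 3 → ℝ) (y : ℝ × ℝ) :
    (f.translate u).planar.active y = f.planar.active (y - planePoint u) := by
  have ht : ∀ a ∈ f.support, (f.translate u).planar.term a y =
      f.planar.term a (y - planePoint u) - k * u 2 := by
    intro a ha
    have h : ((a 0 : ℝ) + a 1 + a 2) = k := by exact_mod_cast hf.sum_eq ha
    simp only [MaxAffine.term, planar, translate, planeDot, planePoint, Fin.sum_univ_three, ← h,
      Prod.fst_sub, Prod.snd_sub]
    ring
  ext a
  constructor
  · rintro ⟨h1, h2⟩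
    refine ⟨h1, fun b hb => ?_⟩
    have := h2 b hb
    rw [ht a h1, ht b hb] at this; linarith
  · rintro ⟨h1, h2⟩
    refine ⟨h1, fun b hb => ?_⟩
    have := h2 b hb
    rw [ht a h1, ht b hb]; linarith

theorem cell_planar_translate (hf : f.IsHomogeneous k) (u : Fin 3 → ℝ) (y : ℝ × ℝ) :
    (f.translate u).planar.cell y = f.planar.cell (y - planePoint u) := by
  rw [MaxAffine.cell, active_planar_translate hf]; rfl

/-- Touching from below at `x` gives an inequality of slopes in every direction; the directions `e`
and `-e` together give equality. -/
theorem eq_linear_of_eventually_le (φ : (Fin 3 → ℝ) →ᵃ[ℝ] ℝ) {a : Fin 3 → ℤ} {x : Fin 3 → ℝ}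
    (hx : f.monomial a x = φ x) (h : ∀ᶠ y in 𝓝 x, f.monomial a y ≤ φ y) (e : Fin 3 → ℝ) :
    ∑ i, (a i : ℝ) * e i = φ.linear e := by
  have hdir : ∀ e : Fin 3 → ℝ, ∑ i, (a i : ℝ) * e i ≤ φ.linear e := by
    intro e
    have hlim : Tendsto (fun t : ℝ => x + t • e) (𝓝[>] 0) (𝓝 x) := by
      have : Tendsto (fun t : ℝ => x + t • e) (𝓝 0) (𝓝 (x + (0 : ℝ) • e)) :=
        Continuous.tendsto (by fun_prop) 0
      rw [zero_smul, add_zero] at this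
      exact this.mono_left nhdsWithin_le_nhds
    obtain ⟨t, ht, ht0⟩ := ((hlim.eventually h).and eventually_mem_nhdsWithin).exists
    rw [Set.mem_Ioi] at ht0
    have h1 : φ (x + t • e) = t * φ.linear e + φ x := by
      have := φ.map_vadd x (t • e)
      rw [vadd_eq_add, vadd_eq_add, map_smul, smul_eq_mul, add_comm] at this
      exact this
    have h2 : f.monomial a (x + t • e) = f.monomial a x + t * ∑ i, (a i : ℝ) * e i := by
      simp only [monomial, Pi.add_apply, Pi.smul_apply, smul_eq_mul, mul_add, Finset.sum_add_distrib,
        Finset.mul_sum]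
      rw [add_assoc]; congr 2
      exact Finset.sum_congr rfl fun i _ => by ring
    rw [h1, h2, hx] at ht
    nlinarith
  refine le_antisymm (hdir e) ?_
  have := hdir (-e)
  simp only [Pi.neg_apply, mul_neg, Finset.sum_neg_distrib, map_neg] at this
  linarith

/-- If `f` is affine near `x`, every active monomial has its linear part, hence the same exponent.
Conversely, a single active monomial stays the only one nearby. -/
theorem mem_variety_iff (hf : f.IsHomogeneous k) (x : Fin 3 → ℝ) :
    x ∈ f.variety ↔ ¬ (f.planar.active (planePoint x)).Subsingleton := by
  rw [variety, Set.mem_ofPred_eq, not_iff_not]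
  constructor
  · rintro ⟨φ, hφ⟩ a ha b hb
    have key : ∀ a ∈ f.planar.active (planePoint x), ∀ e : Fin 3 → ℝ,
        ∑ i, (a i : ℝ) * e i = φ.linear e := by
      intro a ha
      have ha' := (mem_active_iff hf a x).2 ha
      refine eq_linear_of_eventually_le φ (f := f) (ha'.2.trans hφ.self_of_nhds) ?_
      filter_upwards [hφ] with y hy
      rw [← hy]
      exact Finset.le_sup' (fun a => f.monomial a y) ha'.1
    ext i
    have h1 := (key a ha (Pi.single i 1)).trans (key b hb (Pi.single i 1)).symm
    simpa [Pi.single_apply] using h1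
  · intro hs
    obtain ⟨a, ha⟩ := f.planar.active_nonempty (planePoint x)
    refine ⟨(∑ i, (a i : ℝ) • LinearMap.proj (R := ℝ) (φ := fun _ : Fin 3 => ℝ) i).toAffineMap +
      AffineMap.const ℝ _ (f.coeff a), ?_⟩
    filter_upwards [continuous_planePoint.continuousAt.eventually
      (f.planar.active_subset_of_nhds (planePoint x))] with y hy
    obtain ⟨b, hb⟩ := f.planar.active_nonempty (planePoint y)
    obtain rfl := hs ha (hy hb)
    rw [← ((mem_active_iff hf a y).2 hb).2, monomial]
    simp [add_comm]

/-- The first two coordinates are injective on the directions of the cell, whose coordinate sum is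
zero. By Cramer's rule they are surjective as soon as three exponents are not collinear. -/
theorem finrank_vectorSpan_dualCell (hf : f.IsHomogeneous k) {x : Fin 3 → ℝ} {a b c : Fin 3 → ℤ}
    (ha : a ∈ f.planar.active (planePoint x)) (hb : b ∈ f.planar.active (planePoint x))
    (hc : c ∈ f.planar.active (planePoint x)) (h : expCross a b c ≠ 0) :
    Module.finrank ℝ (vectorSpan ℝ (f.dualCell x)) = 2 := by
  rw [dualCell_eq hf]
  set A := f.planar.active (planePoint x)
  have hmem : ∀ a ∈ A, intVec a ∈ convexHull ℝ (intVec '' A) := fun a ha =>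
    subset_convexHull ℝ _ (Set.mem_image_of_mem _ ha)
  let V := vectorSpan ℝ (convexHull ℝ (intVec '' A))
  let s : (Fin 3 → ℝ) →ₗ[ℝ] ℝ := LinearMap.proj (R := ℝ) (φ := fun _ : Fin 3 => ℝ) 0 + LinearMap.proj 1 + LinearMap.proj 2
  have hs : V ≤ LinearMap.ker s := by
    have hk : convexHull ℝ (intVec '' A) ⊆ {y | s y = k} := by
      refine convexHull_min ?_ (convex_hyperplane s.isLinear _)
      rintro _ ⟨a, ha, rfl⟩
      have := hf.sum_eq (f.planar.active_subset _ ha)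
      change (a 0 : ℝ) + a 1 + a 2 = k
      exact_mod_cast this
    refine Submodule.span_le.2 ?_
    rintro _ ⟨y, hy, z, hz, rfl⟩
    have h1 : s y = k := hk hy
    have h2 : s z = k := hk hz
    simp [vsub_eq_sub, h1, h2]
  let φ : V →ₗ[ℝ] ℝ × ℝ :=
    ((LinearMap.proj (R := ℝ) (φ := fun _ : Fin 3 => ℝ) 0).prod (LinearMap.proj 1)).comp V.subtype
  have hinj : Function.Injective φ := by
    rw [← LinearMap.ker_eq_bot, LinearMap.ker_eq_bot']
    rintro ⟨y, hy⟩ h0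
    have h1 : y 0 = 0 := congrArg Prod.fst h0
    have h2 : y 1 = 0 := congrArg Prod.snd h0
    have h3 : y 0 + y 1 + y 2 = 0 := hs hy
    ext i; fin_cases i
    · exact h1
    · exact h2
    · change y 2 = 0; linarith
  have hsurj : Function.Surjective φ := by
    intro p
    have h' : ((b 0 : ℝ) - a 0) * (c 1 - a 1) - (b 1 - a 1) * (c 0 - a 0) ≠ 0 := by
      exact_mod_cast h
    set D := ((b 0 : ℝ) - a 0) * (c 1 - a 1) - (b 1 - a 1) * (c 0 - a 0)
    have hb' : intVec b - intVec a ∈ V := vsub_mem_vectorSpan ℝ (hmem b hb) (hmem a ha)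
    have hc' : intVec c - intVec a ∈ V := vsub_mem_vectorSpan ℝ (hmem c hc) (hmem a ha)
    refine ⟨((p.1 * (c 1 - a 1) - p.2 * (c 0 - a 0)) / D) • ⟨_, hb'⟩ +
      ((p.2 * (b 0 - a 0) - p.1 * (b 1 - a 1)) / D) • ⟨_, hc'⟩, ?_⟩
    rw [map_add, map_smul, map_smul]
    have hφb : φ ⟨_, hb'⟩ = ((b 0 : ℝ) - a 0, (b 1 : ℝ) - a 1) := rfl
    have hφc : φ ⟨_, hc'⟩ = ((c 0 : ℝ) - a 0, (c 1 : ℝ) - a 1) := rfl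
    rw [hφb, hφc]
    ext
    · simp only [Prod.fst_add, Prod.smul_fst, smul_eq_mul]
      rw [div_mul_eq_mul_div, div_mul_eq_mul_div, ← add_div, div_eq_iff h']; ring
    · simp only [Prod.snd_add, Prod.smul_snd, smul_eq_mul]
      rw [div_mul_eq_mul_div, div_mul_eq_mul_div, ← add_div, div_eq_iff h']; ring
  rw [(LinearEquiv.ofBijective φ ⟨hinj, hsurj⟩).finrank_eq]
  simp

theorem exists_isLatticeSegment_active (hf : f.IsHomogeneous k) {x : Fin 3 → ℝ}
    (hx : x ∈ f.variety)
    (h : ∀ a ∈ f.planar.active (planePoint x), ∀ b ∈ f.planar.active (planePoint x),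
      ∀ c ∈ f.planar.active (planePoint x), expCross a b c = 0) :
    ∃ a w m, IsLatticeSegment (f.planar.active (planePoint x)) a w m :=
  exists_isLatticeSegment (f.planar.finite_active _) ((mem_variety_iff hf x).1 hx)
    (fun _ ha => hf.sum_eq (f.planar.active_subset _ ha)) h

theorem IsVertex.exists_expCross_ne_zero (hf : f.IsHomogeneous k) {x : Fin 3 → ℝ}
    (hx : f.IsVertex x) : ∃ a ∈ f.planar.active (planePoint x),
      ∃ b ∈ f.planar.active (planePoint x), ∃ c ∈ f.planar.active (planePoint x),
        expCross a b c ≠ 0 := by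
  by_contra! hn
  obtain ⟨a, w, m, hw⟩ := exists_isLatticeSegment_active hf hx.1 hn
  have h2 := hx.2
  rw [dualCell_eq hf] at h2
  have hle : vectorSpan ℝ (convexHull ℝ (intVec '' f.planar.active (planePoint x))) ≤
      Submodule.span ℝ {intVec w} := by
    rw [← direction_affineSpan, affineSpan_convexHull, direction_affineSpan]
    refine Submodule.span_le.2 ?_
    rintro _ ⟨_, ⟨b, hb, rfl⟩, _, ⟨c, hc, rfl⟩, rfl⟩
    obtain ⟨i, -, rfl⟩ := hw.exists_eq b hb
    obtain ⟨j, -, rfl⟩ := hw.exists_eq c hc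
    refine Submodule.mem_span_singleton.2 ⟨(i : ℝ) - j, ?_⟩
    ext t
    simp [intVec]; ring
  have := Submodule.finrank_mono hle
  have := (finrank_span_le_card (R := ℝ) {intVec w}).trans (by simp : _ ≤ 1)
  omega

/-- The directions of an edge are the primitive vectors orthogonal to its dual segment. -/
theorem IsLatticeSegment.orthogonal (hf : f.IsHomogeneous k) {x : Fin 3 → ℝ}
    {a w v : Fin 3 → ℤ} {m : ℕ} (hw : IsLatticeSegment (f.planar.active (planePoint x)) a w m)
    (hv : f.IsPrimitiveDirection x v) : w 0 * (v 0 - v 2) + w 1 * (v 1 - v 2) = 0 := by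
  have hlim : Tendsto (fun t : ℝ => x + t • intVec v) (𝓝 0) (𝓝 x) := by
    have : Tendsto (fun t : ℝ => x + t • intVec v) (𝓝 0) (𝓝 (x + (0 : ℝ) • intVec v)) :=
      Continuous.tendsto (by fun_prop) 0
    rwa [zero_smul, add_zero] at this
  have hev := (hv.2.and (hlim.eventually (continuous_planePoint.continuousAt.eventually
    (f.planar.active_subset_of_nhds (planePoint x))))).filter_mono
      (nhdsWithin_le_nhds (s := Set.Ioi (0 : ℝ)))
  obtain ⟨t, ⟨ht1, ht2⟩, ht0⟩ := (hev.and eventually_mem_nhdsWithin).exists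
  rw [Set.mem_Ioi] at ht0
  rw [mem_variety_iff hf, Set.not_subsingleton_iff] at ht1
  -- Two exponents that tie at `x` and at `x + t • v` have difference orthogonal to `v`, and this
  -- difference is a nonzero multiple of `w`.
  obtain ⟨b, hb, c, hc, hbc⟩ := ht1
  have e1 : f.planar.term b (planePoint x) = f.planar.term c (planePoint x) :=
    le_antisymm ((ht2 hc).2 b (ht2 hb).1) ((ht2 hb).2 c (ht2 hc).1)
  have e2 : f.planar.term b (planePoint (x + t • intVec v)) =
      f.planar.term c (planePoint (x + t • intVec v)) := le_antisymm (hc.2 b hb.1) (hb.2 c hc.1)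
  obtain ⟨i, -, rfl⟩ := hw.exists_eq b (ht2 hb)
  obtain ⟨j, -, rfl⟩ := hw.exists_eq c (ht2 hc)
  have hij : (i : ℝ) - j ≠ 0 := by
    intro h0
    apply hbc
    have : i = j := by exact_mod_cast sub_eq_zero.1 h0
    rw [this]
  have h3 : (((i : ℝ) - j) * t) * (w 0 * (v 0 - v 2) + w 1 * (v 1 - v 2)) = 0 := by
    simp only [MaxAffine.term, planar, planeDot, planePoint, Pi.add_apply, Pi.smul_apply, intVec,
      smul_eq_mul, Int.cast_add, Int.cast_mul, Int.cast_natCast] at e1 e2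
    linear_combination e2 - e1
  have h4 := (mul_eq_zero.1 h3).resolve_left (mul_ne_zero hij ht0.ne')
  exact_mod_cast h4

/-- Moving orthogonally to `w` changes all active terms equally, so their tie persists. -/
theorem IsLatticeSegment.isPrimitiveDirection (hf : f.IsHomogeneous k) {x : Fin 3 → ℝ}
    {a w : Fin 3 → ℤ} {m : ℕ} (hw : IsLatticeSegment (f.planar.active (planePoint x)) a w m) :
    f.IsPrimitiveDirection x ![-w 1, w 0, 0] := by
  refine ⟨?_, ?_⟩
  · have := Int.isCoprime_iff_gcd_eq_one.1 hw.coprime.symm.neg_left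
    simpa using this
  have hlim : Tendsto (fun t : ℝ => x + t • intVec ![-w 1, w 0, 0]) (𝓝 0) (𝓝 x) := by
    have : Tendsto (fun t : ℝ => x + t • intVec ![-w 1, w 0, 0]) (𝓝 0)
        (𝓝 (x + (0 : ℝ) • intVec ![-w 1, w 0, 0])) := Continuous.tendsto (by fun_prop) 0
    rwa [zero_smul, add_zero] at this
  filter_upwards [hlim.eventually (continuous_planePoint.continuousAt.eventually
    (f.planar.active_subset_of_nhds (planePoint x)))] with t ht
  rw [mem_variety_iff hf]
  obtain ⟨b, hb⟩ := f.planar.active_nonempty (planePoint (x + t • intVec ![-w 1, w 0, 0]))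
  have hterm : ∀ c ∈ f.planar.active (planePoint x),
      f.planar.term c (planePoint (x + t • intVec ![-w 1, w 0, 0])) =
        f.planar.term b (planePoint (x + t • intVec ![-w 1, w 0, 0])) := by
    intro c hc
    have e1 : f.planar.term c (planePoint x) = f.planar.term b (planePoint x) :=
      le_antisymm ((ht hb).2 c hc.1) (hc.2 b hb.1)
    obtain ⟨i, -, rfl⟩ := hw.exists_eq b (ht hb)
    obtain ⟨j, -, rfl⟩ := hw.exists_eq c hc
    simp only [MaxAffine.term, planar, planeDot, planePoint, Pi.add_apply, Pi.smul_apply, intVec,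
      smul_eq_mul, Int.cast_add, Int.cast_mul, Int.cast_natCast, Matrix.cons_val, Int.cast_neg,
      Int.cast_zero] at e1 ⊢
    linear_combination e1
  have hall : ∀ c ∈ f.planar.active (planePoint x),
      c ∈ f.planar.active (planePoint (x + t • intVec ![-w 1, w 0, 0])) :=
    fun c hc => ⟨hc.1, fun d hd => (hb.2 d hd).trans (hterm c hc).ge⟩
  intro hs
  have h := hs (hall _ hw.left_mem) (hall _ hw.right_mem)
  have hm := hw.pos.ne'
  have h0 : w 0 = 0 := by simpa [hm] using congrFun h 0
  have h1 : w 1 = 0 := by simpa [hm] using congrFun h 1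
  have := hw.coprime
  rw [h0, h1] at this
  exact not_isCoprime_zero_zero this

/-- Orthogonality makes the direction an integer multiple of the rotated `w`, and the factor divides
the gcd of a primitive vector, so it is a sign. -/
theorem IsLatticeSegment.exists_primitiveDirection (hf : f.IsHomogeneous k) {x : Fin 3 → ℝ}
    {a w : Fin 3 → ℤ} {m : ℕ} (hw : IsLatticeSegment (f.planar.active (planePoint x)) a w m) :
    ∃ s : ℤ, s.natAbs = 1 ∧ f.primitiveDirection x 0 - f.primitiveDirection x 2 = -(s * w 1) ∧
      f.primitiveDirection x 1 - f.primitiveDirection x 2 = s * w 0 := by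
  have hv : f.IsPrimitiveDirection x (f.primitiveDirection x) :=
    -- The choice is meaningful only once some direction exists, which the explicit rotated vector
    -- provides.
    Classical.epsilon_spec ⟨_, IsLatticeSegment.isPrimitiveDirection hf hw⟩
  have horth := IsLatticeSegment.orthogonal hf hw hv
  obtain ⟨u, v, huv⟩ := hw.coprime
  have hgcd := hv.1
  generalize f.primitiveDirection x 0 - f.primitiveDirection x 2 = p at *
  generalize f.primitiveDirection x 1 - f.primitiveDirection x 2 = q at *
  have hp : p = -((u * q - v * p) * w 1) := by linear_combination -p * huv + u * horth
  have hq : q = (u * q - v * p) * w 0 := by linear_combination -q * huv + v * horth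
  refine ⟨u * q - v * p, ?_, hp, hq⟩
  have h1 : u * q - v * p ∣ (Int.gcd p q : ℤ) :=
    Int.dvd_coe_gcd ⟨-w 1, by linear_combination hp⟩ ⟨w 0, hq⟩
  rw [hgcd] at h1
  exact Int.natAbs_eq_natAbs_iff.2 (Int.isUnit_iff.1 (isUnit_of_dvd_one (by simpa using h1)))

theorem IsLatticeSegment.weight_eq (hf : f.IsHomogeneous k) {x : Fin 3 → ℝ}
    {a w : Fin 3 → ℤ} {m : ℕ} (hw : IsLatticeSegment (f.planar.active (planePoint x)) a w m) :
    f.weight x = m := by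
  rw [weight, dualCell_eq hf, hw.ncard_lattice_points, Nat.add_sub_cancel]

theorem IsLatticeSegment.cell_eq {y : ℝ × ℝ} {a w : Fin 3 → ℤ} {m : ℕ}
    (hw : IsLatticeSegment (f.planar.active y) a w m) :
    f.planar.cell y = segment ℝ ((a 0 : ℝ), (a 1 : ℝ))
      (((a 0 : ℝ), (a 1 : ℝ)) + (m : ℝ) • ((w 0 : ℝ), (w 1 : ℝ))) := by
  have hslope : ∀ j : ℤ, f.planar.slope (a + j • w) =
      ((a 0 : ℝ), (a 1 : ℝ)) + (j : ℝ) • ((w 0 : ℝ), (w 1 : ℝ)) := by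
    intro j; ext <;> simp [planar]
  refine convexHull_image_eq_segment hw.pos (fun b hb => ?_) ⟨a, hw.left_mem, rfl⟩
    ⟨_, hw.right_mem, by rw [hslope]; simp⟩
  obtain ⟨j, hj, rfl⟩ := hw.exists_eq b hb
  exact ⟨j, hj, by rw [hslope]; simp⟩

theorem cell_eq_singleton_of_notMem_variety (hf : f.IsHomogeneous k) {x : Fin 3 → ℝ}
    (hx : x ∉ f.variety) : ∃ p, f.planar.cell (planePoint x) = {p} := by
  rw [mem_variety_iff hf, not_not] at hx
  obtain ⟨a, ha⟩ := f.planar.active_nonempty (planePoint x)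
  exact ⟨f.planar.slope a, by
    rw [MaxAffine.cell, hx.eq_singleton_of_mem ha, Set.image_singleton, convexHull_singleton]⟩

/-- The multiplicity of a transversal intersection point is the mixed area of the dual cells. -/
theorem intersectionMultiplicity_eq_mixedArea (hf : f.IsHomogeneous k) (hg : g.IsHomogeneous l)
    (ht : Transversal f g) (x : Fin 3 → ℝ) : (intersectionMultiplicity f g x : ℝ) =
      mixedArea (f.planar.cell (planePoint x)) (g.planar.cell (planePoint x)) := by
  unfold intersectionMultiplicity
  split_ifs with hx
  · have hfv : ¬ f.IsVertex x := fun h => ht.1 x h hx.2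
    have hgv : ¬ g.IsVertex x := fun h => ht.2 x h hx.1
    -- Since `x` lies on both curves, transversality says that it is a vertex of neither, so the
    -- active exponents of each are collinear.
    obtain ⟨a, w, m, hw⟩ := exists_isLatticeSegment_active hf hx.1 fun a ha b hb c hc => by
      by_contra h
      exact hfv ⟨hx.1, finrank_vectorSpan_dualCell hf ha hb hc h⟩
    obtain ⟨a', w', m', hw'⟩ := exists_isLatticeSegment_active hg hx.2 fun a ha b hb c hc => by
      by_contra h
      exact hgv ⟨hx.2, finrank_vectorSpan_dualCell hg ha hb hc h⟩
    obtain ⟨s, hs, hs0, hs1⟩ := IsLatticeSegment.exists_primitiveDirection hf hw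
    obtain ⟨s', hs', hs0', hs1'⟩ := IsLatticeSegment.exists_primitiveDirection hg hw'
    have hdet : (Matrix.det !![f.primitiveDirection x 0, f.primitiveDirection x 1,
        f.primitiveDirection x 2; g.primitiveDirection x 0, g.primitiveDirection x 1,
        g.primitiveDirection x 2; 1, 1, 1]).natAbs = (w 0 * w' 1 - w 1 * w' 0).natAbs := by
      have : Matrix.det !![f.primitiveDirection x 0, f.primitiveDirection x 1,
        f.primitiveDirection x 2; g.primitiveDirection x 0, g.primitiveDirection x 1,
        g.primitiveDirection x 2; 1, 1, 1] = s * (s' * (w 0 * w' 1 - w 1 * w' 0)) := by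
        rw [Matrix.det_fin_three]
        simp only [Matrix.of_apply, Matrix.cons_val]
        -- The row of ones reduces the determinant to the cross product of the directions in affine
        -- coordinates; rotating both segments by a right angle preserves it.
        have e : ∀ p q r p' q' r' : ℤ, p * q' * 1 - p * r' * 1 - q * p' * 1 + q * r' * 1 +
            r * p' * 1 - r * q' * 1 = (p - r) * (q' - r') - (q - r) * (p' - r') := by
          intros; ring
        rw [e, hs0, hs1, hs0', hs1']; ring
      rw [this, Int.natAbs_mul, Int.natAbs_mul, hs, hs', one_mul, one_mul]
    simp only [hdet]
    rw [IsLatticeSegment.weight_eq hf hw, IsLatticeSegment.weight_eq hg hw',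
      IsLatticeSegment.cell_eq hw, IsLatticeSegment.cell_eq hw', mixedArea_segment]
    have hc : planeCross ((m : ℝ) • ((w 0 : ℝ), (w 1 : ℝ))) ((m' : ℝ) • ((w' 0 : ℝ), (w' 1 : ℝ))) =
        (m * m') * (w 0 * w' 1 - w 1 * w' 0) := by
      simp only [planeCross, Prod.smul_fst, Prod.smul_snd, smul_eq_mul]; ring
    rw [hc, abs_mul, abs_of_nonneg (by positivity), Nat.cast_mul, Nat.cast_mul, Nat.cast_natAbs]
    push_cast
    rfl
  · rw [not_and_or] at hx
    rcases hx with hx | hx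
    · obtain ⟨p, hp⟩ := cell_eq_singleton_of_notMem_variety hf hx
      rw [hp, mixedArea_singleton_left, Nat.cast_zero]
    · obtain ⟨p, hp⟩ := cell_eq_singleton_of_notMem_variety hg hx
      rw [hp, mixedArea_comm, mixedArea_singleton_left, Nat.cast_zero]

end TropPoly

end PlaneCurves

/-! ### Genericity of transversality, and the degree as a mixed area. -/

section PlaneCurves

open MeasureTheory
open scoped Pointwise

/-- The representative with last coordinate zero of the point with affine coordinates `y`. -/
def planeLift (y : ℝ × ℝ) : Fin 3 → ℝ := ![y.1, y.2, 0]

theorem planePoint_planeLift (y : ℝ × ℝ) : planePoint (planeLift y) = y := by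
  ext <;> simp [planePoint, planeLift]

theorem continuous_planeLift : Continuous planeLift := by
  refine continuous_pi fun i => ?_
  fin_cases i
  · exact continuous_fst
  · exact continuous_snd
  · exact continuous_const

namespace TropPoly

variable {f g : TropPoly 3} {k l : ℤ}

/-- Three non-collinear active exponents determine the point: it is a tie point of the family with
itself. -/
theorem finite_noncollinear_active (f : TropPoly 3) :
    {y : ℝ × ℝ | ∃ a ∈ f.planar.active y, ∃ b ∈ f.planar.active y, ∃ c ∈ f.planar.active y,
      expCross a b c ≠ 0}.Finite := by
  refine ((((f.support ×ˢ f.support) ×ˢ (f.support ×ˢ f.support)).finite_toSet).image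
    fun q => f.planar.tiePoint f.planar q 0).subset ?_
  rintro y ⟨a, ha, b, hb, c, hc, h⟩
  refine ⟨((b, a), (c, a)), ?_, ?_⟩
  · simp only [Finset.mem_coe, Finset.mem_product]
    exact ⟨⟨hb.1, ha.1⟩, ⟨hc.1, ha.1⟩⟩
  · refine (MaxAffine.eq_tiePoint ?_ ?_ ?_ ?_ ?_).symm
    · simp only [planeCross, planar, Prod.fst_sub, Prod.snd_sub]
      exact_mod_cast h
    all_goals simpa

/-- The locus lies on finitely many lines, one for each pair of exponents; by homogeneity distinct
exponents have distinct slopes, so these are proper lines. -/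
theorem volume_not_subsingleton_active (hf : f.IsHomogeneous k) :
    volume {y | ¬ (f.planar.active y).Subsingleton} = 0 := by
  have hsub : {y | ¬ (f.planar.active y).Subsingleton} ⊆
      ⋃ q ∈ {q : (Fin 3 → ℤ) × (Fin 3 → ℤ) | q ∈ f.support ×ˢ f.support ∧ q.1 ≠ q.2},
        {y | planeDot y (f.planar.slope q.1 - f.planar.slope q.2) =
          f.coeff q.2 - f.coeff q.1} := by
    intro y hy
    obtain ⟨a, ha, b, hb, hab⟩ := Set.not_subsingleton_iff.1 hy
    refine Set.mem_biUnion (x := (a, b)) ⟨Finset.mk_mem_product ha.1 hb.1, hab⟩ ?_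
    have h1 := ha.2 b hb.1
    have h2 := hb.2 a ha.1
    simp only [MaxAffine.term, planeDot] at h1 h2
    simp only [Set.mem_ofPred_eq, planeDot, Prod.fst_sub, Prod.snd_sub]
    simp only [planar] at *
    linarith
  refine measure_mono_null hsub ((measure_biUnion_null_iff
    (((f.support ×ˢ f.support).finite_toSet.subset fun q hq => hq.1).countable)).2 ?_)
  rintro ⟨a, b⟩ ⟨hq, hne⟩
  refine volume_line_eq_zero (fun h0 => hne ?_) _
  have hq' := Finset.mem_product.1 hq
  have h1 := congrArg Prod.fst h0
  have h2 := congrArg Prod.snd h0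
  simp only [planar, Prod.fst_sub, Prod.snd_sub, Prod.fst_zero, Prod.snd_zero, sub_eq_zero,
    Int.cast_inj] at h1 h2
  have h3 := hf.sum_eq hq'.1
  have h4 := hf.sum_eq hq'.2
  simp only at h3 h4 ⊢
  ext i; fin_cases i
  · exact h1
  · exact h2
  · change a 2 = b 2; omega

/-- Almost all translates of a plane tropical curve meet a given one transversally. -/
theorem ae_transversal (hf : f.IsHomogeneous k) (hg : g.IsHomogeneous l) :
    ∀ᵐ u : ℝ × ℝ, Transversal (f.translate (planeLift u)) g := by
  -- For each of the finitely many vertices `y` of one curve, the shifts moving it onto the other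
  -- curve form a translate of a null set. In the next claim, where the vertex is fixed and the
  -- curve moves, they form a reflected translate.
  have h1 : ∀ᵐ u : ℝ × ℝ, ∀ y ∈ {y : ℝ × ℝ | ∃ a ∈ f.planar.active y, ∃ b ∈ f.planar.active y,
      ∃ c ∈ f.planar.active y, expCross a b c ≠ 0}, (g.planar.active (y + u)).Subsingleton := by
    rw [ae_ball_iff f.finite_noncollinear_active.countable]
    intro y _
    have := volume_not_subsingleton_active hg
    rw [← measure_preimage_add volume y] at this
    exact this
  have h2 : ∀ᵐ u : ℝ × ℝ, ∀ y ∈ {y : ℝ × ℝ | ∃ a ∈ g.planar.active y, ∃ b ∈ g.planar.active y,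
      ∃ c ∈ g.planar.active y, expCross a b c ≠ 0}, (f.planar.active (y - u)).Subsingleton := by
    rw [ae_ball_iff g.finite_noncollinear_active.countable]
    intro y _
    have h := volume_not_subsingleton_active hf
    rw [← (Measure.measurePreserving_sub_left volume y).measure_preimage
      (NullMeasurableSet.of_null h)] at h
    exact h
  filter_upwards [h1, h2] with u hu1 hu2
  refine ⟨fun x hx => ?_, fun x hx => ?_⟩
  · have hv := hx.exists_expCross_ne_zero (hf.translate _)
    simp only [active_planar_translate hf, planePoint_planeLift] at hv
    have := hu1 _ hv
    rw [sub_add_cancel] at this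
    rwa [mem_variety_iff hg, not_not]
  · have := hu2 _ (hx.exists_expCross_ne_zero hg)
    rwa [mem_variety_iff (hf.translate _), not_not, active_planar_translate hf,
      planePoint_planeLift]

theorem frequently_transversal (hf : f.IsHomogeneous k) (hg : g.IsHomogeneous l) :
    ∃ᶠ p : (Fin 3 → ℝ) × (Fin 3 → ℝ) in 𝓝 0, Transversal (f.translate p.1) (g.translate p.2) := by
  have h0 : planeLift 0 = 0 := by
    ext i; fin_cases i <;> simp [planeLift]
  have hlim : Tendsto (fun u : ℝ × ℝ => (planeLift u, (0 : Fin 3 → ℝ))) (𝓝 0) (𝓝 0) :=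
    (continuous_planeLift.prodMk continuous_const).tendsto' 0 0 (by rw [h0]; rfl)
  have hg0 : g.translate 0 = g := by
    simp [translate]
  have hd : ∃ᶠ u : ℝ × ℝ in 𝓝 0, Transversal (f.translate (planeLift u)) (g.translate 0) := by
    rw [hg0]
    exact mem_closure_iff_frequently.1 (Measure.dense_of_ae (ae_transversal hf hg) 0)
  exact hlim.frequently hd

theorem triangle_eq (d : ℕ) :
    triangle d = {y : Fin 3 → ℝ | 0 ≤ y 0 ∧ 0 ≤ y 1 ∧ 0 ≤ y 2 ∧ y 0 + y 1 + y 2 = d} := by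
  apply subset_antisymm
  · refine convexHull_min ?_ ?_
    · rintro y (rfl | rfl | rfl) <;> simp
    · rintro y ⟨h1, h2, h3, h4⟩ z ⟨h1', h2', h3', h4'⟩ a b ha hb hab
      simp only [Set.mem_ofPred_eq, Pi.add_apply, Pi.smul_apply, smul_eq_mul]
      refine ⟨by positivity, by positivity, by positivity, ?_⟩
      linear_combination a * h4 + b * h4' + (d : ℝ) * hab
  · rintro y ⟨h0, h1, h2, hsum⟩
    -- The barycentric coordinates `y i / d` require `d ≠ 0`; for `d = 0` the triangle is a point.
    rcases Nat.eq_zero_or_pos d with rfl | hd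
    · refine subset_convexHull ℝ _ (Or.inl ?_)
      rw [Nat.cast_zero] at hsum
      ext i; fin_cases i
      · simp; linarith
      · simp; linarith
      · simp; linarith
    · have hd' : (0 : ℝ) < d := by exact_mod_cast hd
      have hmem := (convex_convexHull ℝ ({![(d : ℝ), 0, 0], ![0, (d : ℝ), 0],
        ![0, 0, (d : ℝ)]} : Set (Fin 3 → ℝ))).sum_mem (t := Finset.univ) (w := fun i => y i / d)
        (z := ![![(d : ℝ), 0, 0], ![0, (d : ℝ), 0], ![0, 0, (d : ℝ)]]) (by
          intro i _
          have : 0 ≤ y i := by fin_cases i <;> assumption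
          positivity)
        (by rw [← Finset.sum_div, Fin.sum_univ_three, hsum, div_self hd'.ne'])
        (by
          intro i _
          refine subset_convexHull ℝ _ ?_
          fin_cases i <;> simp)
      convert! hmem using 1
      rw [Fin.sum_univ_three]
      ext i; fin_cases i <;> simp [hd'.ne']

theorem fitsInside_iff (hf : f.IsHomogeneous k) (d : ℕ) :
    f.FitsInside d ↔ ∃ t : Fin 3 → ℤ, k + (t 0 + t 1 + t 2) = d ∧
      ∀ a ∈ f.support, ∀ i, 0 ≤ a i + t i := by
  refine exists_congr fun t => ?_
  rw [Set.image_subset_iff, newtonPolytope]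
  have hconv : Convex ℝ ((fun p => p + intVec t) ⁻¹' triangle d) :=
    (convex_convexHull ℝ _).translate_preimage_left (intVec t)
  have : convexHull ℝ (intVec '' (f.support : Set (Fin 3 → ℤ))) ⊆
      (fun p => p + intVec t) ⁻¹' triangle d ↔ ∀ a ∈ f.support, intVec a + intVec t ∈ triangle d :=
    ⟨fun h a ha => h (subset_convexHull ℝ _ (Set.mem_image_of_mem _ ha)), fun h =>
      convexHull_min (by rintro _ ⟨a, ha, rfl⟩; exact h a ha) hconv⟩
  rw [this, triangle_eq]
  have hmem : ∀ a ∈ f.support, (intVec a + intVec t ∈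
      {y : Fin 3 → ℝ | 0 ≤ y 0 ∧ 0 ≤ y 1 ∧ 0 ≤ y 2 ∧ y 0 + y 1 + y 2 = d} ↔
      (∀ i, 0 ≤ a i + t i) ∧ k + (t 0 + t 1 + t 2) = d) := by
    intro a ha
    have hs := hf.sum_eq ha
    simp only [Set.mem_ofPred_eq, Pi.add_apply, intVec]
    rw [Fin.forall_fin_succ, Fin.forall_fin_succ, Fin.forall_fin_one, and_assoc, and_assoc]
    refine and_congr (by norm_cast) (and_congr (by norm_cast) (and_congr (by norm_cast) ?_))
    rw [← hs]
    have : a 0 + a 1 + a 2 + (t 0 + t 1 + t 2) = (a 0 + t 0) + (a 1 + t 1) + (a 2 + t 2) := by ring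
    rw [this]
    norm_cast
  constructor
  · intro h
    obtain ⟨a, ha⟩ := f.nonempty
    exact ⟨((hmem a ha).1 (h a ha)).2, fun b hb => ((hmem b hb).1 (h b hb)).1⟩
  · rintro ⟨h1, h2⟩ a ha
    exact (hmem a ha).2 ⟨h2 a ha, h1⟩

/-- The smallest `i`-th coordinate of the exponents of `f`. -/
def minExponent (f : TropPoly 3) (i : Fin 3) : ℤ := f.support.inf' f.nonempty fun a => a i

theorem minExponent_le {a : Fin 3 → ℤ} (ha : a ∈ f.support) (i : Fin 3) : f.minExponent i ≤ a i :=
  Finset.inf'_le (fun a : Fin 3 → ℤ => a i) ha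

theorem exists_eq_minExponent (f : TropPoly 3) (i : Fin 3) :
    ∃ a ∈ f.support, a i = f.minExponent i := by
  obtain ⟨a, ha, h⟩ := Finset.exists_mem_eq_inf' f.nonempty fun a : Fin 3 → ℤ => a i
  exact ⟨a, ha, h.symm⟩

/-- The most economical translation moves each minimal exponent to zero; the coordinate sum left
after it is the degree. -/
theorem HasDegree.eq (hf : f.IsHomogeneous k) {d : ℕ} (hd : f.HasDegree d) :
    (d : ℤ) = k - (f.minExponent 0 + f.minExponent 1 + f.minExponent 2) := by
  obtain ⟨t, ht, hnn⟩ := (fitsInside_iff hf d).1 hd.1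
  have hle : ∀ i, -f.minExponent i ≤ t i := by
    intro i
    obtain ⟨a, ha, h⟩ := f.exists_eq_minExponent i
    have := hnn a ha i
    omega
  have h0 := hle 0
  have h1 := hle 1
  have h2 := hle 2
  by_contra hne
  obtain ⟨a, ha⟩ := f.nonempty
  have hsum := hf.sum_eq ha
  have m0 := minExponent_le ha 0
  have m1 := minExponent_le ha 1
  have m2 := minExponent_le ha 2
  refine hd.2 (k - (f.minExponent 0 + f.minExponent 1 + f.minExponent 2)).toNat (by omega)
    ((fitsInside_iff hf _).2 ⟨fun i => -f.minExponent i, ?_, fun b hb i => ?_⟩)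
  · change k + (-f.minExponent 0 + -f.minExponent 1 + -f.minExponent 2) = _
    omega
  · have := minExponent_le hb i
    change 0 ≤ b i + -f.minExponent i
    omega

theorem isLeast_image_hull {φ : ℝ × ℝ → ℝ} (hφ : IsLinearMap ℝ φ) {c : ℝ}
    (h : IsLeast (φ '' (f.planar.slope '' (f.support : Set (Fin 3 → ℤ)))) c) :
    IsLeast (φ '' f.planar.hull) c := by
  refine ⟨Set.image_mono (subset_convexHull ℝ _) h.1, ?_⟩
  have : f.planar.hull ⊆ {p | c ≤ φ p} :=
    convexHull_min (fun p hp => h.2 (Set.mem_image_of_mem φ hp)) (convex_halfSpace_ge hφ c)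
  rintro _ ⟨p, hp, rfl⟩
  exact this hp

theorem isGreatest_image_hull {φ : ℝ × ℝ → ℝ} (hφ : IsLinearMap ℝ φ) {c : ℝ}
    (h : IsGreatest (φ '' (f.planar.slope '' (f.support : Set (Fin 3 → ℤ)))) c) :
    IsGreatest (φ '' f.planar.hull) c := by
  refine ⟨Set.image_mono (subset_convexHull ℝ _) h.1, ?_⟩
  have : f.planar.hull ⊆ {p | φ p ≤ c} :=
    convexHull_min (fun p hp => h.2 (Set.mem_image_of_mem φ hp)) (convex_halfSpace_le hφ c)
  rintro _ ⟨p, hp, rfl⟩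
  exact this hp

/-- The minimal exponents are the least coordinates of the hull, and by homogeneity the greatest
value of `x.1 + x.2` is `l - minExponent 2`; the size of the circumscribed triangle is therefore the
degree. -/
theorem mixedArea_planeTriangle_hull (hg : g.IsHomogeneous l) {d : ℕ} (hd : g.HasDegree d)
    (c : ℕ) : mixedArea (planeTriangle c) g.planar.hull = c * d := by
  have hdeg : (d : ℝ) = (l - g.minExponent 2) - g.minExponent 0 - g.minExponent 1 := by
    have := hd.eq hg
    have h : (d : ℝ) = ((l - (g.minExponent 0 + g.minExponent 1 + g.minExponent 2) : ℤ) : ℝ) := by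
      exact_mod_cast this
    rw [h]; push_cast; ring
  rw [hdeg]
  refine mixedArea_planeTriangle g.planar.isCompact_hull (convex_convexHull ℝ _)
    (Nat.cast_nonneg c) (isLeast_image_hull ⟨fun _ _ => rfl, fun _ _ => rfl⟩ ⟨?_, ?_⟩)
    (isLeast_image_hull ⟨fun _ _ => rfl, fun _ _ => rfl⟩ ⟨?_, ?_⟩)
    (isGreatest_image_hull ⟨fun p q => ?_, fun t p => ?_⟩ ⟨?_, ?_⟩)
  · obtain ⟨a, ha, h⟩ := g.exists_eq_minExponent 0
    exact ⟨_, ⟨a, ha, rfl⟩, by simp [planar, h]⟩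
  · rintro _ ⟨_, ⟨a, ha, rfl⟩, rfl⟩
    have := minExponent_le ha 0
    simp only [planar]; exact_mod_cast this
  · obtain ⟨a, ha, h⟩ := g.exists_eq_minExponent 1
    exact ⟨_, ⟨a, ha, rfl⟩, by simp [planar, h]⟩
  · rintro _ ⟨_, ⟨a, ha, rfl⟩, rfl⟩
    have := minExponent_le ha 1
    simp only [planar]; exact_mod_cast this
  · simp only [Prod.fst_add, Prod.snd_add]; ring
  · simp only [Prod.smul_fst, Prod.smul_snd, smul_eq_mul]; ring
  · obtain ⟨a, ha, h⟩ := g.exists_eq_minExponent 2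
    refine ⟨_, ⟨a, ha, rfl⟩, ?_⟩
    have h1 := hg.sum_eq ha
    have h2 : a 0 + a 1 = l - g.minExponent 2 := by omega
    simp only [planar]; exact_mod_cast h2
  · rintro _ ⟨_, ⟨a, ha, rfl⟩, rfl⟩
    have h1 := hg.sum_eq ha
    have := minExponent_le ha 2
    have h2 : a 0 + a 1 ≤ l - g.minExponent 2 := by omega
    simp only [planar]; exact_mod_cast h2

theorem HasFullSupport.exists_add_hull {c : ℕ} (hf : f.HasFullSupport c) :
    ∃ p : ℝ × ℝ, {p} + f.planar.hull = planeTriangle c := by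
  obtain ⟨t, ht⟩ := hf
  let P : (Fin 3 → ℝ) →ₗ[ℝ] ℝ × ℝ :=
    (LinearMap.proj (R := ℝ) (φ := fun _ : Fin 3 => ℝ) 0).prod (LinearMap.proj 1)
  have hhull : f.planar.hull = P '' f.newtonPolytope := by
    rw [newtonPolytope, P.image_convexHull, Set.image_image]; rfl
  have htri : P '' triangle c = planeTriangle c := by
    rw [triangle_eq]
    ext p
    constructor
    · rintro ⟨y, ⟨h0, h1, h2, h3⟩, rfl⟩
      exact ⟨h0, h1, by change y 0 + y 1 ≤ c; linarith⟩
    · rintro ⟨h0, h1, h2⟩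
      exact ⟨![p.1, p.2, c - p.1 - p.2], ⟨h0, h1, by simp; linarith, by simp⟩, rfl⟩
  refine ⟨P (intVec t), ?_⟩
  rw [hhull, ← htri, ← ht, Set.image_image, Set.singleton_add, Set.image_image]
  exact Set.image_congr fun y _ => by rw [map_add, add_comm]

theorem mixedArea_hull (hf : f.IsHomogeneous k) (hg : g.IsHomogeneous l) {c d : ℕ}
    (hc : f.HasDegree c) (hd : g.HasDegree d) (h : f.HasFullSupport c ∨ g.HasFullSupport d) :
    mixedArea f.planar.hull g.planar.hull = c * d := by
  rcases h with h | h
  · obtain ⟨p, hp⟩ := h.exists_add_hull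
    rw [← mixedArea_singleton_add_left p, hp, mixedArea_planeTriangle_hull hg hd]
  · obtain ⟨p, hp⟩ := h.exists_add_hull
    rw [mixedArea_comm, ← mixedArea_singleton_add_left p, hp, mixedArea_planeTriangle_hull hf hc,
      mul_comm]

end TropPoly

end PlaneCurves

/-! ### Matchings of multisets, and existence and uniqueness of the stable intersection. -/

section StableIntersection

theorem Multiset.Rel.finset_sum {ι α β : Type*} {r : α → β → Prop} (s : Finset ι)
    {F : ι → Multiset α} {G : ι → Multiset β} (h : ∀ i ∈ s, Multiset.Rel r (F i) (G i)) :
    Multiset.Rel r (∑ i ∈ s, F i) (∑ i ∈ s, G i) := by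
  classical
  induction s using Finset.induction_on with
  | empty => exact Multiset.Rel.zero
  | insert a s ha ih =>
    rw [Finset.sum_insert ha, Finset.sum_insert ha]
    exact (h a (Finset.mem_insert_self a s)).add
      (ih fun i hi => h i (Finset.mem_insert_of_mem hi))

/-- Two matchings with the same multiset `T` compose; this is the triangle inequality for
convergence of multisets. -/
theorem Multiset.Rel.exists_common {α β γ : Type*} {r : α → β → Prop} {r' : α → γ → Prop}
    {T : Multiset α} : ∀ {S : Multiset β} {S' : Multiset γ}, Multiset.Rel r T S →
      Multiset.Rel r' T S' → Multiset.Rel (fun b c => ∃ a, r a b ∧ r' a c) S S' := by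
  induction T using Multiset.induction_on with
  | empty =>
    intro S S' h h'
    rw [Multiset.rel_zero_left] at h h'
    rw [h, h']; exact Multiset.Rel.zero
  | cons a T ih =>
    intro S S' h h'
    obtain ⟨b, S, hb, hS, rfl⟩ := Multiset.rel_cons_left.1 h
    obtain ⟨c, S', hc, hS', rfl⟩ := Multiset.rel_cons_left.1 h'
    exact Multiset.Rel.cons ⟨a, hb, hc⟩ (ih hS hS')

namespace TropProj

theorem dist_pos_of_ne {n : ℕ} {P Q : TropProj n} (h : P ≠ Q) : 0 < dist P Q := by
  -- Closedness of the line makes the quotient seminorm a norm.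
  have : IsClosed (Submodule.span ℝ {(1 : Fin (n + 1) → ℝ)} : Set (Fin (n + 1) → ℝ)) :=
    Submodule.closed_of_finiteDimensional _
  exact dist_pos.2 h

/-- Below the least positive distance between a point of `S` and a point of `S'`, matched points
must coincide. -/
theorem eq_of_forall_rel_dist_lt {n : ℕ} {S S' : Multiset (TropProj n)}
    (h : ∀ ε > 0, Multiset.Rel (fun P Q => dist P Q < ε) S S') : S = S' := by
  classical
  obtain ⟨δ, hδ, hsep⟩ := (S.toFinset ×ˢ S'.toFinset).exists_pos_forall
    (P := fun q r => q.1 ≠ q.2 → r ≤ dist q.1 q.2) (by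
      rintro ⟨P, Q⟩ _
      by_cases hPQ : P = Q
      · exact ⟨1, one_pos, fun h => absurd hPQ h⟩
      · exact ⟨dist P Q, dist_pos_of_ne hPQ, fun _ => le_rfl⟩)
    (fun q r s _ hsr hq hne => hsr.trans (hq hne))
  refine Multiset.rel_eq.1 ((h δ hδ).mono fun P hP Q hQ hPQ => ?_)
  by_contra hne
  exact absurd hPQ (not_lt.2 (hsep (P, Q) (Finset.mk_mem_product (Multiset.mem_toFinset.2 hP)
    (Multiset.mem_toFinset.2 hQ)) hne))

theorem mk_eq_mk_planeLift_iff (x : Fin 3 → ℝ) (y : ℝ × ℝ) :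
    TropProj.mk (n := 2) x = TropProj.mk (planeLift y) ↔ planePoint x = y := by
  rw [TropProj.mk, TropProj.mk, Submodule.Quotient.eq, Submodule.mem_span_singleton]
  constructor
  · rintro ⟨t, ht⟩
    have h0 := congrFun ht 0
    have h1 := congrFun ht 1
    have h2 := congrFun ht 2
    simp [planeLift] at h0 h1 h2
    ext
    · simp only [planePoint]; linarith
    · simp only [planePoint]; linarith
  · rintro rfl
    refine ⟨x 2, ?_⟩
    ext i; fin_cases i <;> simp [planeLift, planePoint]

theorem dist_mk_planeLift_le (y z : ℝ × ℝ) :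
    dist (TropProj.mk (n := 2) (planeLift y)) (TropProj.mk (planeLift z)) ≤ dist y z := by
  rw [dist_eq_norm, dist_eq_norm, TropProj.mk, TropProj.mk, ← Submodule.Quotient.mk_sub]
  refine (Submodule.Quotient.norm_mk_le _ _).trans ((pi_norm_le_iff_of_nonneg (norm_nonneg _)).2 ?_)
  intro i; fin_cases i
  · exact norm_fst_le (y - z)
  · exact norm_snd_le (y - z)
  · simp [planeLift]

end TropProj

namespace TropPoly

variable {f g : TropPoly 3} {k l : ℤ}

theorem IsTransversalIntersection.unique {T T' : Multiset (TropProj 2)}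
    (h : IsTransversalIntersection f g T) (h' : IsTransversalIntersection f g T') : T = T' := by
  classical
  ext P
  obtain ⟨x, rfl⟩ := Submodule.Quotient.mk_surjective _ P
  have h1 := h x
  have h2 := h' x
  rw [TropProj.mk] at h1 h2
  convert! h1.trans h2.symm

/-- The intersection multiset supported on the points with affine coordinates in `Z`. -/
theorem isTransversalIntersection_sum (hf : f.IsHomogeneous k) (hg : g.IsHomogeneous l)
    (ht : Transversal f g) {Z : Finset (ℝ × ℝ)}
    (hZ : ∀ y, mixedArea (f.planar.cell y) (g.planar.cell y) ≠ 0 → y ∈ Z) :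
    IsTransversalIntersection f g (∑ y ∈ Z,
      Multiset.replicate (intersectionMultiplicity f g (planeLift y))
        (TropProj.mk (planeLift y))) := by
  classical
  intro x
  have hx := intersectionMultiplicity_eq_mixedArea hf hg ht x
  have hx' := intersectionMultiplicity_eq_mixedArea hf hg ht (planeLift (planePoint x))
  rw [planePoint_planeLift, ← hx, Nat.cast_inj] at hx'
  have hcount : ∀ y, Multiset.count (TropProj.mk x)
      (Multiset.replicate (intersectionMultiplicity f g (planeLift y))
        (TropProj.mk (n := 2) (planeLift y))) =
      if planePoint x = y then intersectionMultiplicity f g x else 0 := by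
    intro y
    rw [Multiset.count_replicate]
    by_cases hy : planePoint x = y
    · rw [if_pos hy, if_pos ((TropProj.mk_eq_mk_planeLift_iff x y).2 hy).symm, ← hy, hx']
    · rw [if_neg hy, if_neg fun h => hy ((TropProj.mk_eq_mk_planeLift_iff x y).1 h.symm)]
  have hsum : Multiset.count (TropProj.mk x) (∑ y ∈ Z,
      Multiset.replicate (intersectionMultiplicity f g (planeLift y))
        (TropProj.mk (n := 2) (planeLift y))) = intersectionMultiplicity f g x := by
    rw [Multiset.count_sum', Finset.sum_congr rfl fun y _ => hcount y, Finset.sum_ite_eq]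
    split_ifs with h
    · rfl
    · by_contra hne
      refine h (hZ _ ?_)
      rw [← hx]
      exact_mod_cast Ne.symm hne
  convert! hsum

theorem shiftedMixedArea_planar (hf : f.IsHomogeneous k) (hg : g.IsHomogeneous l)
    (p : (Fin 3 → ℝ) × (Fin 3 → ℝ)) (y : ℝ × ℝ) :
    mixedArea ((f.translate p.1).planar.cell y) ((g.translate p.2).planar.cell y) =
      f.planar.shiftedMixedArea g.planar (planePoint p.1, planePoint p.2) y := by
  rw [cell_planar_translate hf, cell_planar_translate hg]; rfl

theorem cast_intersectionMultiplicity_translate (hf : f.IsHomogeneous k)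
    (hg : g.IsHomogeneous l) {p : (Fin 3 → ℝ) × (Fin 3 → ℝ)}
    (ht : Transversal (f.translate p.1) (g.translate p.2)) (y : ℝ × ℝ) :
    (intersectionMultiplicity (f.translate p.1) (g.translate p.2) (planeLift y) : ℝ) =
      f.planar.shiftedMixedArea g.planar (planePoint p.1, planePoint p.2) y := by
  rw [intersectionMultiplicity_eq_mixedArea (hf.translate _) (hg.translate _) ht,
    planePoint_planeLift, shiftedMixedArea_planar hf hg]

theorem tendsto_planePoint_prod :
    Tendsto (fun p : (Fin 3 → ℝ) × (Fin 3 → ℝ) => (planePoint p.1, planePoint p.2)) (𝓝 0)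
      (𝓝 (0 : (ℝ × ℝ) × (ℝ × ℝ))) := by
  refine Continuous.tendsto' ?_ 0 0 ?_
  · exact (continuous_planePoint.comp continuous_fst).prodMk
      (continuous_planePoint.comp continuous_snd)
  · simp [planePoint]

/-- Transversal translates occur arbitrarily close to zero; one such intersection is within `ε / 2`
of both limits. -/
theorem IsStableIntersection.unique (hf : f.IsHomogeneous k) (hg : g.IsHomogeneous l)
    {S S' : Multiset (TropProj 2)} (hS : IsStableIntersection f g S)
    (hS' : IsStableIntersection f g S') : S = S' := by
  refine TropProj.eq_of_forall_rel_dist_lt fun ε hε => ?_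
  obtain ⟨p, hp, h1, h2⟩ := ((frequently_transversal hf hg).and_eventually
    ((hS (ε / 2) (half_pos hε)).and (hS' (ε / 2) (half_pos hε)))).exists
  obtain ⟨T, hT, hTS⟩ := h1 hp
  obtain ⟨T', hT', hTS'⟩ := h2 hp
  obtain rfl := hT.unique hT'
  refine (hTS.exists_common hTS').mono ?_
  rintro P - Q - ⟨R, h, h'⟩
  calc dist P Q ≤ dist R P + dist R Q := dist_triangle_left _ _ _
    _ < ε := by linarith

/-- The balls around the points of `X` are disjoint and cover the support of `F`, so each nonzero
term is counted exactly once. -/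
theorem sum_sum_filter_dist {M : Type*} [AddCommMonoid M] {X Z : Finset (ℝ × ℝ)} {F : ℝ × ℝ → M}
    {ε : ℝ} (hX : ∀ y ∈ X, ∀ z ∈ X, y ≠ z → 2 * ε ≤ dist y z)
    (hF : ∀ x, F x ≠ 0 → ∃ y ∈ X, dist x y < ε) :
    ∑ y ∈ X, ∑ x ∈ Z with dist x y < ε, F x = ∑ x ∈ Z, F x := by
  simp only [Finset.sum_filter]
  rw [Finset.sum_comm]
  refine Finset.sum_congr rfl fun x _ => ?_
  by_cases hx : F x = 0
  · simp [hx]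
  obtain ⟨y, hy, hxy⟩ := hF x hx
  rw [Finset.sum_eq_single_of_mem y hy, if_pos hxy]
  intro z hz hzy
  refine if_neg fun hxz => ?_
  have h1 := hX z hz y hy hzy
  have h2 := dist_triangle_left z y x
  linarith

/-- The stable intersection of two plane tropical curves exists and is unique, and its size is the
mixed area of the Newton polygons. -/
theorem exists_isStableIntersection (hf : f.IsHomogeneous k) (hg : g.IsHomogeneous l) :
    ∃ S : Multiset (TropProj 2), (∀ T, IsStableIntersection f g T ↔ T = S) ∧
      (Multiset.card S : ℝ) = mixedArea f.planar.hull g.planar.hull := by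
  obtain ⟨X, r, hr, hX, hloc⟩ := f.planar.exists_sum_shiftedMixedArea g.planar
  have htotal : ∀ p : (Fin 3 → ℝ) × (Fin 3 → ℝ), ∃ Z : Finset (ℝ × ℝ),
      (∀ x, f.planar.shiftedMixedArea g.planar (planePoint p.1, planePoint p.2) x ≠ 0 → x ∈ Z) ∧
      ∑ x ∈ Z, f.planar.shiftedMixedArea g.planar (planePoint p.1, planePoint p.2) x =
        mixedArea f.planar.hull g.planar.hull := by
    intro p
    obtain ⟨Z, hZ, hsum⟩ :=
      MaxAffine.exists_sum_mixedArea (f.translate p.1).planar (g.translate p.2).planar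
    simp only [shiftedMixedArea_planar hf hg] at hZ hsum
    exact ⟨Z, hZ, hsum⟩
  -- The mixed area of the cells at `y` is a sum of multiplicities of a nearby transversal
  -- intersection, hence a natural number and usable as a multiplicity.
  have hnat : ∀ y, ∃ n : ℕ, y ∈ X →
      (n : ℝ) = mixedArea (f.planar.cell y) (g.planar.cell y) := by
    intro y
    by_cases hy : y ∈ X
    · obtain ⟨p, hp, -, h2⟩ := ((frequently_transversal hf hg).and_eventually
        (tendsto_planePoint_prod.eventually (hloc r hr le_rfl))).exists
      obtain ⟨Z, hZ, -⟩ := htotal p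
      refine ⟨∑ x ∈ Z with dist x y < r,
        intersectionMultiplicity (f.translate p.1) (g.translate p.2) (planeLift x), fun _ => ?_⟩
      rw [Nat.cast_sum, ← h2 y hy Z hZ]
      exact Finset.sum_congr rfl fun x _ => cast_intersectionMultiplicity_translate hf hg hp x
    · exact ⟨0, fun h => absurd h hy⟩
  choose n hn using hnat
  have hstable : IsStableIntersection f g
      (∑ y ∈ X, Multiset.replicate (n y) (TropProj.mk (planeLift y))) := by
    intro ε hε
    -- Taking the minimum with `r` keeps the balls around `X` disjoint even for large `ε`.
    filter_upwards [tendsto_planePoint_prod.eventually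
      (hloc (min ε r) (lt_min hε hr) (min_le_right _ _))] with p hp htrans
    obtain ⟨Z, hZ, -⟩ := htotal p
    have hmult := cast_intersectionMultiplicity_translate hf hg htrans
    refine ⟨_, isTransversalIntersection_sum (hf.translate _) (hg.translate _) htrans
      (Z := Z) fun y hy => hZ y (by rwa [← shiftedMixedArea_planar hf hg]), ?_⟩
    rw [← sum_sum_filter_dist (X := X) (ε := min ε r)]
    · refine Multiset.Rel.finset_sum X fun y hy => ?_
      rw [Multiset.rel_replicate_right]
      constructor
      · rw [Multiset.card_sum]
        simp only [Multiset.card_replicate]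
        have h := hp.2 y hy Z hZ
        simp only [← hmult, ← hn y hy] at h
        exact_mod_cast h
      · intro P hP
        obtain ⟨x, hx, hPx⟩ := Multiset.mem_sum.1 hP
        rw [Multiset.eq_of_mem_replicate hPx]
        exact (TropProj.dist_mk_planeLift_le x y).trans_lt
          ((Finset.mem_filter.1 hx).2.trans_le (min_le_left _ _))
    · intro y hy z hz hyz
      linarith [hX y hy z hz hyz, min_le_right ε r]
    · intro x hx
      refine hp.1 x fun h0 => hx ?_
      rw [← hmult, Nat.cast_eq_zero] at h0
      rw [h0, Multiset.replicate_zero]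
  refine ⟨_, fun T => ⟨fun hT => hT.unique hf hg hstable, fun hT => hT ▸ hstable⟩, ?_⟩
  -- A single small pair of translates links the local sums, which give the multiplicities of the
  -- limit, to the global sum.
  obtain ⟨p, hp, h⟩ := ((frequently_transversal hf hg).and_eventually
    (tendsto_planePoint_prod.eventually (hloc r hr le_rfl))).exists
  obtain ⟨Z, hZ, hsum⟩ := htotal p
  rw [← hsum, Multiset.card_sum, Nat.cast_sum, ← sum_sum_filter_dist (X := X) (ε := r) hX h.1]
  refine Finset.sum_congr rfl fun y hy => ?_
  rw [Multiset.card_replicate, hn y hy, h.2 y hy Z hZ]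

end TropPoly

end StableIntersection

/-- Strong tropical Bézout: if at least one of two plane tropical curves of degrees `c` and `d`
has full support, then they have a well-defined stable intersection, and it consists of `c * d`
points, counted with multiplicities. -/
theorem mainTheorem5 (f g : TropPoly 3) (k l : ℤ)
    (hf : f.IsHomogeneous k) (hg : g.IsHomogeneous l) (c d : ℕ)
    (hc : f.HasDegree c) (hd : g.HasDegree d)
    (hfull : f.HasFullSupport c ∨ g.HasFullSupport d) :
    ∃ S : Multiset (TropProj 2),
      (∀ T : Multiset (TropProj 2), TropPoly.IsStableIntersection f g T ↔ T = S) ∧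
        Multiset.card S = c * d := by
  obtain ⟨S, hS, hcard⟩ := TropPoly.exists_isStableIntersection hf hg
  refine ⟨S, hS, ?_⟩
  rw [TropPoly.mixedArea_hull hf hg hc hd hfull] at hcard
  exact_mod_cast hcard
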